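/- A frequency is a strictly increasing sequence $\lambda=(\lambda_n)$ of non-negative real numbers with $\lambda_n\to\infty$. For $k\ge 0$, a $\lambda$-Dirichlet series $D=\sum a_n e^{-\lambda_n s}$ (a formal series, given by its complex coefficients $a_n$) is called $(\lambda,k)$-Riesz summable at $s\in\mathbb{C}$ if the limit of the Riesz means $$R_x^{\lambda,k}(D)(s)=\sum_{\lambda_n<x}a_n e^{-\lambda_n s}\Big(1-\frac{\lambda_n}{x}\Big)^k$$ as $x\to\infty$ exists. $D$ is a $\lambda$-Riesz germ of a holomorphic function $f:[\operatorname{Re}>0]\to\mathbb{C}$ if there are $m\ge 0$ and $\sigma\in\mathbb{R}$ such that $R_x^{\lambda,m}(D)(s)\to f(s)$ for all $s$ with $\operatorname{Re}s>\max(\sigma,0)$. For $\ell\ge 0$ let $H_{\infty,\ell}^{\lambda}[\operatorname{Re}>0]$ be the space of all holomorphic $f:[\operatorname{Re}>0]\to\mathbb{C}$ that have a $\lambda$-Riesz germ and satisfy $$\|f\|_{\infty,\ell}=\sup_{\operatorname{Re}s>0}\frac{|f(s)|}{(1+|s|)^{\ell}}<\infty .$$ Let $\mathcal{D}_{\infty,\ell}(\lambda)$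 be the space of all $\lambda$-Dirichlet series $D$ that are $(\lambda,\ell)$-Riesz summable at every point of $[\operatorname{Re}>0]$ and whose limit function $f(s)=\lim_{x\to\infty}R_x^{\lambda,\ell}(D)(s)$ belongs to $H_{\infty,\ell}^{\lambda}[\operatorname{Re}>0]$, with $\|D\|_{\infty,\ell}=\|f\|_{\infty,\ell}$. For $u\ge 0$ the translation of $D=\sum a_ne^{-\lambda_ns}$ by $u$ is $D_u=\sum a_n e^{-\lambda_n u}e^{-\lambda_n s}$. Theorem. Let $\lambda$ be a frequency and $\ell\ge 0$. Then the following are equivalent: (1) $\mathcal{D}_{\infty,\ell}(\lambda)$ satisfies Montel's theorem: for every sequence $(D^{(N)})$ in $\mathcal{D}_{\infty,\ell}(\lambda)$ with $\sup_N\|D^{(N)}\|_{\infty,\ell}<\infty$ there are a subsequence $(D^{(N_j)})_j$ and some $E\in\mathcal{D}_{\infty,\ell}(\lambda)$ such that for every $u>0$ the translations $D^{(N_j)}_u$ converge to $E_u$ in $\mathcal{D}_{\infty,\ell}(\lambda)$ as $j\to\infty$. (2) $\mathcal{D}_{\infty,\ell}(\lambda)$ is a Banach space, i.e. $\|\cdot\|_{\infty,\ell}$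 is a norm on it for which it is complete. (3) For every $f\in H_{\infty,\ell}^{\lambda}[\operatorname{Re}>0]$, every $\lambda$-Riesz germ of $f$ is $(\lambda,\ell)$-Riesz summable at every point of $[\operatorname{Re}>0]$. (4) $\mathcal{D}_{\infty,\ell}(\lambda)=H_{\infty,\ell}^{\lambda}[\operatorname{Re}>0]$ isometrically and coefficient-preservingly: there is a linear isometric bijection $\Phi:\mathcal{D}_{\infty,\ell}(\lambda)\to H_{\infty,\ell}^{\lambda}[\operatorname{Re}>0]$ such that for every $D\in\mathcal{D}_{\infty,\ell}(\lambda)$ the series $D$ is the one and only $\lambda$-Riesz germ of $\Phi(D)$. -/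

import Mathlib

open Filter Topology MeasureTheory
open scoped NNReal

/-- A frequency: a strictly increasing, unbounded sequence of non-negative real numbers. -/
structure Frequency where
  toFun : ℕ → ℝ
  strictMono : StrictMono toFun
  nonneg : ∀ n, 0 ≤ toFun n
  tendsto : Tendsto toFun atTop atTop

instance : CoeFun Frequency (fun _ => ℕ → ℝ) := ⟨Frequency.toFun⟩

theorem Frequency.finite_lt (lam : Frequency) (x : ℝ) : {n | lam n < x}.Finite := by
  have h := lam.tendsto.eventually_ge_atTop x
  obtain ⟨N, hN⟩ := eventually_atTop.1 h
  refine (Set.finite_lt_nat N).subset fun n hn => ?_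
  by_contra hc
  exact absurd (hN n (not_lt.1 hc)) (not_le.2 hn)

/-- The finite set of indices `n` with `lam n < x`. -/
noncomputable def Frequency.below (lam : Frequency) (x : ℝ) : Finset ℕ :=
  (lam.finite_lt x).toFinset

theorem Frequency.mem_below (lam : Frequency) (x : ℝ) (n : ℕ) :
    n ∈ lam.below x ↔ lam n < x := by
  simp [Frequency.below]

/-- The Riesz mean `∑_{lam n < x} a n * exp (-lam n * s) * (1 - lam n / x) ^ k` of order `k` of the
Dirichlet series with coefficients `a`. -/
noncomputable def rieszMean (lam : Frequency) (k : ℝ) (a : ℕ → ℂ) (x : ℝ) (s : ℂ) : ℂ :=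
  ∑ n ∈ lam.below x, a n * Complex.exp (-(lam n : ℂ) * s) * (((1 - lam n / x) ^ k : ℝ) : ℂ)

/-- `(lam, k)`-Riesz summability at the point `s`. -/
def RieszSummableAt (lam : Frequency) (k : ℝ) (a : ℕ → ℂ) (s : ℂ) : Prop :=
  ∃ L : ℂ, Tendsto (fun x : ℝ => rieszMean lam k a x s) atTop (𝓝 L)

/-- The open right half-plane. -/
abbrev RightHalfPlane : Type := {s : ℂ // 0 < s.re}

/-- `a` is a Riesz germ of `f`: for some order `m ≥ 0` the Riesz means of order `m` of the Dirichlet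
series with coefficients `a` converge to `f` on some half-plane. -/
def IsRieszGerm (lam : Frequency) (a : ℕ → ℂ) (f : RightHalfPlane → ℂ) : Prop :=
  ∃ m : ℝ, 0 ≤ m ∧ ∃ σ : ℝ, ∀ s : RightHalfPlane, σ < (s : ℂ).re →
    Tendsto (fun x : ℝ => rieszMean lam m a x s) atTop (𝓝 (f s))

/-- Holomorphy of a function on the open right half-plane. -/
def IsHolomorphic (f : RightHalfPlane → ℂ) : Prop :=
  ∃ F : ℂ → ℂ, DifferentiableOn ℂ F {s : ℂ | 0 < s.re} ∧ ∀ s : RightHalfPlane, F s = f s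

/-! Linearity of Riesz means. -/

theorem rieszMean_add (lam : Frequency) (k : ℝ) (a b : ℕ → ℂ) (x : ℝ) (s : ℂ) :
    rieszMean lam k (a + b) x s = rieszMean lam k a x s + rieszMean lam k b x s := by
  simp only [rieszMean, Pi.add_apply, add_mul, Finset.sum_add_distrib]

theorem rieszMean_smul (lam : Frequency) (k : ℝ) (c : ℂ) (a : ℕ → ℂ) (x : ℝ) (s : ℂ) :
    rieszMean lam k (c • a) x s = c * rieszMean lam k a x s := by
  simp only [rieszMean, Pi.smul_apply, smul_eq_mul, Finset.mul_sum, mul_assoc]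

theorem rieszMean_zero (lam : Frequency) (k : ℝ) (x : ℝ) (s : ℂ) :
    rieszMean lam k 0 x s = 0 := by
  simp [rieszMean]

/-! Consistency of Riesz summation: means of a higher order converge to the same limit. -/

theorem intervalIntegrable_betaWeight {m p : ℝ} (hm : 0 ≤ m) (hp : 0 < p) :
    IntervalIntegrable (fun u : ℝ => u ^ m * (1 - u) ^ (p - 1)) volume 0 1 := by
  refine IntervalIntegrable.continuousOn_mul ?_ (Real.continuous_rpow_const hm).continuousOn
  have h := (intervalIntegral.intervalIntegrable_rpow' (a := 0) (b := 1)
    (r := p - 1) (by linarith)).comp_sub_left 1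
  simpa using h.symm

theorem integral_betaWeight_pos {m p : ℝ} (hm : 0 ≤ m) (hp : 0 < p) :
    0 < ∫ u in (0 : ℝ)..1, u ^ m * (1 - u) ^ (p - 1) := by
  refine intervalIntegral.intervalIntegral_pos_of_pos_on
    (intervalIntegrable_betaWeight hm hp) (fun u hu => ?_) one_pos
  have h1 : 0 < 1 - u := by linarith [hu.2]
  have h0 := hu.1
  positivity

theorem integral_shifted_betaWeight {m p c : ℝ} (hc : c < 1) :
    ∫ u in c..1, (u - c) ^ m * (1 - u) ^ (p - 1)
      = (1 - c) ^ (m + p) * ∫ u in (0 : ℝ)..1, u ^ m * (1 - u) ^ (p - 1) := by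
  have hd : 0 < 1 - c := by linarith
  have h := intervalIntegral.integral_comp_mul_add (a := 0) (b := 1)
    (fun u : ℝ => (u - c) ^ m * (1 - u) ^ (p - 1)) hd.ne' c
  have e1 : (1 - c) * 0 + c = c := by ring
  have e2 : (1 - c) * 1 + c = 1 := by ring
  rw [e1, e2, smul_eq_mul] at h
  have h2 : ∫ v in (0 : ℝ)..1, ((1 - c) * v + c - c) ^ m * (1 - ((1 - c) * v + c)) ^ (p - 1)
      = (1 - c) ^ (m + p - 1) * ∫ u in (0 : ℝ)..1, u ^ m * (1 - u) ^ (p - 1) := by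
    rw [← intervalIntegral.integral_const_mul]
    refine intervalIntegral.integral_congr fun v hv => ?_
    rw [Set.uIcc_of_le zero_le_one] at hv
    have h3 : (1 - c) * v + c - c = (1 - c) * v := by ring
    have h4 : 1 - ((1 - c) * v + c) = (1 - c) * (1 - v) := by ring
    simp only [h3, h4]
    rw [Real.mul_rpow hd.le hv.1, Real.mul_rpow hd.le (by linarith [hv.2]),
      show m + p - 1 = m + (p - 1) by ring, Real.rpow_add hd]
    ring
  rw [h2] at h
  have h5 : (1 - c) ^ (m + p) = (1 - c) * (1 - c) ^ (m + p - 1) := by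
    rw [show m + p = 1 + (m + p - 1) by ring, Real.rpow_add hd, Real.rpow_one]
    ring_nf
  rw [h5, mul_assoc, h, ← mul_assoc, mul_inv_cancel₀ hd.ne', one_mul]

/-- Riesz means of order `m + p` are weighted averages of Riesz means of order `m`. -/
theorem rieszMean_average (lam : Frequency) {m p : ℝ} (hm : 0 ≤ m) (hp : 0 < p)
    (a : ℕ → ℂ) (s : ℂ) {x : ℝ} (hx : 0 < x) :
    IntegrableOn (fun u : ℝ => ((u ^ m * (1 - u) ^ (p - 1) : ℝ) : ℂ) * rieszMean lam m a (x * u) s)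
      (Set.Ioc 0 1) ∧
    ∫ u in Set.Ioc (0 : ℝ) 1, ((u ^ m * (1 - u) ^ (p - 1) : ℝ) : ℂ) * rieszMean lam m a (x * u) s
      = ((∫ u in (0 : ℝ)..1, u ^ m * (1 - u) ^ (p - 1) : ℝ) : ℂ) * rieszMean lam (m + p) a x s := by
  set w : ℕ → ℝ → ℝ := fun n => (Set.Ioi (lam n / x)).indicator
    (fun u : ℝ => (u - lam n / x) ^ m * (1 - u) ^ (p - 1)) with hw
  have key : ∀ u ∈ Set.Ioc (0 : ℝ) 1,
      ((u ^ m * (1 - u) ^ (p - 1) : ℝ) : ℂ) * rieszMean lam m a (x * u) s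
        = ∑ n ∈ lam.below x, a n * Complex.exp (-(lam n : ℂ) * s) * ((w n u : ℝ) : ℂ) := by
    intro u hu
    have hsub : lam.below (x * u) ⊆ lam.below x := by
      intro n hn
      rw [Frequency.mem_below] at hn ⊢
      nlinarith [hu.1, hu.2]
    rw [rieszMean, Finset.mul_sum]
    refine Finset.sum_subset_zero_on_sdiff hsub (fun n hn => ?_) (fun n hn => ?_)
    · have h1 : ¬ lam n < x * u := by
        have := (Finset.mem_sdiff.1 hn).2
        rwa [Frequency.mem_below] at this
      have h2 : u ∉ Set.Ioi (lam n / x) := by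
        rw [Set.mem_Ioi, div_lt_iff₀ hx, mul_comm]
        exact h1
      simp [hw, Set.indicator_of_notMem h2]
    · rw [Frequency.mem_below] at hn
      have h2 : u ∈ Set.Ioi (lam n / x) := by
        rw [Set.mem_Ioi, div_lt_iff₀ hx, mul_comm]
        exact hn
      have h3 : u ^ m * (1 - lam n / (x * u)) ^ m = (u - lam n / x) ^ m := by
        have hxu : 0 < x * u := mul_pos hx hu.1
        rw [← Real.mul_rpow hu.1.le (by rw [sub_nonneg, div_le_one hxu]; exact hn.le)]
        congr 1
        have := hu.1.ne'
        field_simp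
      simp only [hw, Set.indicator_of_mem h2]
      rw [← h3]
      push_cast
      ring
  have hw_meas : ∀ n ∈ lam.below x, IntegrableOn (w n) (Set.Ioc 0 1) := by
    intro n _
    have hc0 : 0 ≤ lam n / x := div_nonneg (lam.nonneg n) hx.le
    have hI := (intervalIntegrable_iff_integrableOn_Ioc_of_le zero_le_one).1
      (intervalIntegrable_betaWeight hm hp)
    refine Integrable.mono' hI ?_ ?_
    · refine (Measurable.indicator ?_ measurableSet_Ioi).aestronglyMeasurable
      fun_prop
    · refine (ae_restrict_iff' measurableSet_Ioc).2 (Eventually.of_forall fun u hu => ?_)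
      have h1 : 0 ≤ 1 - u := by linarith [hu.2]
      have h0 := hu.1
      by_cases h : u ∈ Set.Ioi (lam n / x)
      · have h' : 0 < u - lam n / x := by simpa using h
        simp only [hw, Set.indicator_of_mem h]
        rw [Real.norm_of_nonneg (by positivity)]
        gcongr
        linarith
      · simp only [hw, Set.indicator_of_notMem h, norm_zero]
        positivity
  have hw_int : ∀ n ∈ lam.below x, ∫ u in Set.Ioc (0 : ℝ) 1, w n u
      = (1 - lam n / x) ^ (m + p) * ∫ u in (0 : ℝ)..1, u ^ m * (1 - u) ^ (p - 1) := by
    intro n hn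
    rw [Frequency.mem_below] at hn
    have hc0 : 0 ≤ lam n / x := div_nonneg (lam.nonneg n) hx.le
    have hc1 : lam n / x < 1 := by rwa [div_lt_one hx]
    rw [← integral_shifted_betaWeight hc1, intervalIntegral.integral_of_le hc1.le]
    simp only [hw]
    rw [setIntegral_indicator measurableSet_Ioi]
    congr 2
    ext u
    simp only [Set.mem_inter_iff, Set.mem_Ioc, Set.mem_Ioi]
    constructor
    · rintro ⟨⟨_, h⟩, h'⟩; exact ⟨h', h⟩
    · rintro ⟨h', h⟩; exact ⟨⟨hc0.trans_lt h', h⟩, h'⟩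
  have hterm : ∀ n ∈ lam.below x, IntegrableOn
      (fun u : ℝ => a n * Complex.exp (-(lam n : ℂ) * s) * ((w n u : ℝ) : ℂ)) (Set.Ioc 0 1) :=
    fun n hn => ((hw_meas n hn).ofReal).const_mul _
  constructor
  · exact (integrableOn_congr_fun key measurableSet_Ioc).2 (integrable_finsetSum _ hterm)
  · rw [setIntegral_congr_fun measurableSet_Ioc key, integral_finsetSum _ hterm, rieszMean,
      Finset.mul_sum]
    refine Finset.sum_congr rfl fun n hn => ?_
    rw [integral_const_mul, integral_complex_ofReal, hw_int n hn]
    push_cast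
    ring

theorem rieszMean_bounded (lam : Frequency) {m : ℝ} (hm : 0 ≤ m) (a : ℕ → ℂ) (s L : ℂ)
    (h : Tendsto (fun x : ℝ => rieszMean lam m a x s) atTop (𝓝 L)) :
    ∃ M : ℝ, ∀ x : ℝ, 0 < x → ‖rieszMean lam m a x s‖ ≤ M := by
  have h1 : ∀ᶠ x : ℝ in atTop, ‖rieszMean lam m a x s‖ < ‖L‖ + 1 :=
    h.norm.eventually_lt_const (by linarith)
  obtain ⟨X, hX⟩ := eventually_atTop.1 h1
  refine ⟨max (‖L‖ + 1) (∑ n ∈ lam.below X, ‖a n * Complex.exp (-(lam n : ℂ) * s)‖),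
    fun x hx => ?_⟩
  rcases le_total X x with hc | hc
  · exact (hX x hc).le.trans (le_max_left _ _)
  · refine le_trans ?_ (le_max_right _ _)
    have hsub : lam.below x ⊆ lam.below X := by
      intro n hn
      rw [Frequency.mem_below] at hn ⊢
      linarith
    refine (norm_sum_le _ _).trans ((Finset.sum_le_sum fun n hn => ?_).trans
      (Finset.sum_le_sum_of_subset_of_nonneg hsub fun _ _ _ => norm_nonneg _))
    rw [Frequency.mem_below] at hn
    have h0 : 0 ≤ 1 - lam n / x := by rw [sub_nonneg, div_le_one hx]; exact hn.le
    have h2 : 1 - lam n / x ≤ 1 := by linarith [div_nonneg (lam.nonneg n) hx.le]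
    rw [norm_mul _ (((1 - lam n / x) ^ m : ℝ) : ℂ), Complex.norm_real,
      Real.norm_of_nonneg (Real.rpow_nonneg h0 m)]
    exact mul_le_of_le_one_right (norm_nonneg _) (Real.rpow_le_one h0 h2 hm)

theorem rieszMean_consistency (lam : Frequency) {m k : ℝ} (hm : 0 ≤ m) (hmk : m ≤ k)
    (a : ℕ → ℂ) (s L : ℂ)
    (h : Tendsto (fun x : ℝ => rieszMean lam m a x s) atTop (𝓝 L)) :
    Tendsto (fun x : ℝ => rieszMean lam k a x s) atTop (𝓝 L) := by
  rcases hmk.eq_or_lt with rfl | hlt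
  · exact h
  obtain ⟨p, hp, rfl⟩ : ∃ p, 0 < p ∧ k = m + p := ⟨k - m, by linarith, by ring⟩
  obtain ⟨M, hM⟩ := rieszMean_bounded lam hm a s L h
  set B : ℝ := ∫ u in (0 : ℝ)..1, u ^ m * (1 - u) ^ (p - 1) with hB
  have hBpos : 0 < B := integral_betaWeight_pos hm hp
  have hBc : (B : ℂ) ≠ 0 := by exact_mod_cast hBpos.ne'
  have hI := (intervalIntegrable_iff_integrableOn_Ioc_of_le zero_le_one).1
      (intervalIntegrable_betaWeight hm hp)
  have hlim : Tendsto (fun x : ℝ => ∫ u in Set.Ioc (0 : ℝ) 1,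
      ((u ^ m * (1 - u) ^ (p - 1) : ℝ) : ℂ) * rieszMean lam m a (x * u) s) atTop
      (𝓝 (∫ u in Set.Ioc (0 : ℝ) 1, ((u ^ m * (1 - u) ^ (p - 1) : ℝ) : ℂ) * L)) := by
    refine tendsto_integral_filter_of_dominated_convergence
      (fun u => u ^ m * (1 - u) ^ (p - 1) * M) ?_ ?_ (hI.mul_const M) ?_
    · filter_upwards [eventually_gt_atTop (0 : ℝ)] with x hx
      exact (rieszMean_average lam hm hp a s hx).1.aestronglyMeasurable
    · filter_upwards [eventually_gt_atTop (0 : ℝ)] with x hx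
      refine (ae_restrict_iff' measurableSet_Ioc).2 (Eventually.of_forall fun u hu => ?_)
      have h1 : 0 ≤ 1 - u := by linarith [hu.2]
      have h0 := hu.1
      rw [norm_mul, Complex.norm_real, Real.norm_of_nonneg (by positivity)]
      exact mul_le_mul_of_nonneg_left (hM _ (mul_pos hx h0)) (by positivity)
    · refine (ae_restrict_iff' measurableSet_Ioc).2 (Eventually.of_forall fun u hu => ?_)
      exact (h.comp (tendsto_id.atTop_mul_const hu.1)).const_mul _
  have hval : ∫ u in Set.Ioc (0 : ℝ) 1, ((u ^ m * (1 - u) ^ (p - 1) : ℝ) : ℂ) * L = B * L := by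
    rw [integral_mul_const, integral_complex_ofReal, hB, intervalIntegral.integral_of_le zero_le_one]
  rw [hval] at hlim
  have h2 := hlim.const_mul ((B : ℂ)⁻¹)
  rw [← mul_assoc, inv_mul_cancel₀ hBc, one_mul] at h2
  refine h2.congr' ?_
  filter_upwards [eventually_gt_atTop (0 : ℝ)] with x hx
  rw [(rieszMean_average lam hm hp a s hx).2, ← hB, ← mul_assoc, inv_mul_cancel₀ hBc, one_mul]

/-! The spaces of holomorphic functions. -/

/-- The growth norm `sup_{Re s > 0} |f s| / (1 + |s|) ^ l`. -/
noncomputable def growthNorm (l : ℝ≥0) (f : RightHalfPlane → ℂ) : ℝ :=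
  ⨆ s : RightHalfPlane, ‖f s‖ / (1 + ‖(s : ℂ)‖) ^ (l : ℝ)

/-- The growth condition, that is, finiteness of the supremum in `growthNorm`. -/
def HasGrowth (l : ℝ≥0) (f : RightHalfPlane → ℂ) : Prop :=
  BddAbove (Set.range fun s : RightHalfPlane => ‖f s‖ / (1 + ‖(s : ℂ)‖) ^ (l : ℝ))

theorem IsRieszGerm.add {lam : Frequency} {a b : ℕ → ℂ} {f g : RightHalfPlane → ℂ}
    (hf : IsRieszGerm lam a f) (hg : IsRieszGerm lam b g) :
    IsRieszGerm lam (a + b) (f + g) := by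
  obtain ⟨m₁, hm₁, σ₁, h₁⟩ := hf
  obtain ⟨m₂, hm₂, σ₂, h₂⟩ := hg
  refine ⟨max m₁ m₂, le_max_of_le_left hm₁, max σ₁ σ₂, fun s hs => ?_⟩
  have e₁ := rieszMean_consistency lam hm₁ (le_max_left m₁ m₂) a s _
    (h₁ s ((le_max_left _ _).trans_lt hs))
  have e₂ := rieszMean_consistency lam hm₂ (le_max_right m₁ m₂) b s _
    (h₂ s ((le_max_right _ _).trans_lt hs))
  simpa only [rieszMean_add, Pi.add_apply] using e₁.add e₂

theorem IsRieszGerm.smul {lam : Frequency} {a : ℕ → ℂ} {f : RightHalfPlane → ℂ} (c : ℂ)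
    (hf : IsRieszGerm lam a f) : IsRieszGerm lam (c • a) (c • f) := by
  obtain ⟨m, hm, σ, h⟩ := hf
  refine ⟨m, hm, σ, fun s hs => ?_⟩
  simpa only [rieszMean_smul, Pi.smul_apply, smul_eq_mul] using (h s hs).const_mul c

theorem IsRieszGerm.zero (lam : Frequency) : IsRieszGerm lam 0 0 :=
  ⟨0, le_rfl, 0, fun s _ => by simp [rieszMean_zero]⟩

theorem IsHolomorphic.add {f g : RightHalfPlane → ℂ} (hf : IsHolomorphic f)
    (hg : IsHolomorphic g) : IsHolomorphic (f + g) := by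
  obtain ⟨F, hF, hFf⟩ := hf
  obtain ⟨G, hG, hGg⟩ := hg
  exact ⟨F + G, hF.add hG, fun s => by simp [hFf, hGg]⟩

theorem IsHolomorphic.smul {f : RightHalfPlane → ℂ} (c : ℂ) (hf : IsHolomorphic f) :
    IsHolomorphic (c • f) := by
  obtain ⟨F, hF, hFf⟩ := hf
  exact ⟨c • F, hF.const_smul c, fun s => by simp [hFf]⟩

theorem HasGrowth.of_le {l : ℝ≥0} {f : RightHalfPlane → ℂ} {C : ℝ}
    (h : ∀ s : RightHalfPlane, ‖f s‖ / (1 + ‖(s : ℂ)‖) ^ (l : ℝ) ≤ C) : HasGrowth l f :=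
  ⟨C, by rintro _ ⟨s, rfl⟩; exact h s⟩

theorem HasGrowth.le {l : ℝ≥0} {f : RightHalfPlane → ℂ} (h : HasGrowth l f)
    (s : RightHalfPlane) : ‖f s‖ / (1 + ‖(s : ℂ)‖) ^ (l : ℝ) ≤ growthNorm l f :=
  le_ciSup h s

theorem growthNorm_le {l : ℝ≥0} {f : RightHalfPlane → ℂ} {C : ℝ}
    (h : ∀ s : RightHalfPlane, ‖f s‖ / (1 + ‖(s : ℂ)‖) ^ (l : ℝ) ≤ C) : growthNorm l f ≤ C :=
  haveI : Nonempty RightHalfPlane := ⟨⟨1, by simp⟩⟩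
  ciSup_le h

theorem growthNorm_nonneg (l : ℝ≥0) (f : RightHalfPlane → ℂ) : 0 ≤ growthNorm l f :=
  Real.iSup_nonneg fun s => by positivity

theorem growth_add_le {l : ℝ≥0} {f g : RightHalfPlane → ℂ} (hf : HasGrowth l f)
    (hg : HasGrowth l g) (s : RightHalfPlane) :
    ‖(f + g) s‖ / (1 + ‖(s : ℂ)‖) ^ (l : ℝ) ≤ growthNorm l f + growthNorm l g := by
  refine le_trans ?_ (add_le_add (hf.le s) (hg.le s))
  rw [← add_div]
  exact div_le_div_of_nonneg_right (norm_add_le _ _) (by positivity)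

theorem growthNorm_smul (l : ℝ≥0) (c : ℂ) (f : RightHalfPlane → ℂ) :
    growthNorm l (c • f) = ‖c‖ * growthNorm l f := by
  rw [growthNorm, growthNorm, Real.mul_iSup_of_nonneg (norm_nonneg c)]
  simp only [Pi.smul_apply, norm_smul, mul_div_assoc]

theorem HasGrowth.smul {l : ℝ≥0} {f : RightHalfPlane → ℂ} (c : ℂ) (hf : HasGrowth l f) :
    HasGrowth l (c • f) :=
  HasGrowth.of_le (C := ‖c‖ * growthNorm l f) fun s => by
    rw [Pi.smul_apply, norm_smul, mul_div_assoc]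
    exact mul_le_mul_of_nonneg_left (hf.le s) (norm_nonneg c)

/-- The linear space `H_{∞,l}^lam[Re > 0]` of all holomorphic functions on the right half-plane
that are generated by a Riesz germ and satisfy the growth condition. -/
def HSubmodule (lam : Frequency) (l : ℝ≥0) : Submodule ℂ (RightHalfPlane → ℂ) where
  carrier := {f | IsHolomorphic f ∧ HasGrowth l f ∧ ∃ a : ℕ → ℂ, IsRieszGerm lam a f}
  add_mem' := by
    rintro f g ⟨hf, hf', a, ha⟩ ⟨hg, hg', b, hb⟩
    exact ⟨hf.add hg, HasGrowth.of_le (growth_add_le hf' hg'), a + b, ha.add hb⟩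
  zero_mem' :=
    ⟨⟨0, differentiableOn_const 0, fun _ => rfl⟩, HasGrowth.of_le (C := 0) (by simp), 0,
      IsRieszGerm.zero lam⟩
  smul_mem' := by
    rintro c f ⟨hf, hf', a, ha⟩
    exact ⟨hf.smul c, hf'.smul c, c • a, ha.smul c⟩

/-- `H_{∞,l}^lam[Re > 0]` as a type, which carries the growth norm (and not the topology of
pointwise convergence). -/
def RieszHSpace (lam : Frequency) (l : ℝ≥0) : Type := HSubmodule lam l

noncomputable instance (lam : Frequency) (l : ℝ≥0) : AddCommGroup (RieszHSpace lam l) :=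
  inferInstanceAs (AddCommGroup (HSubmodule lam l))

noncomputable instance (lam : Frequency) (l : ℝ≥0) : Module ℂ (RieszHSpace lam l) :=
  inferInstanceAs (Module ℂ (HSubmodule lam l))

/-- The function on the right half-plane that underlies an element of `RieszHSpace lam l`. -/
def RieszHSpace.fn {lam : Frequency} {l : ℝ≥0} (f : RieszHSpace lam l) : RightHalfPlane → ℂ :=
  Subtype.val f

noncomputable instance (lam : Frequency) (l : ℝ≥0) : Norm (RieszHSpace lam l) :=
  ⟨fun f => growthNorm l f.fn⟩

theorem RieszHSpace.norm_def {lam : Frequency} {l : ℝ≥0} (f : RieszHSpace lam l) :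
    ‖f‖ = growthNorm l f.fn := rfl

theorem RieszHSpace.core (lam : Frequency) (l : ℝ≥0) : NormedSpace.Core ℂ (RieszHSpace lam l) where
  norm_nonneg f := growthNorm_nonneg l f.fn
  norm_smul c f := growthNorm_smul l c f.fn
  norm_triangle f g := growthNorm_le (growth_add_le f.2.2.1 g.2.2.1)
  norm_eq_zero_iff f := by
    constructor
    · intro h
      refine Subtype.ext (funext fun s => ?_)
      have h1 : ‖f.fn s‖ / (1 + ‖(s : ℂ)‖) ^ (l : ℝ) ≤ 0 :=
        (HasGrowth.le f.2.2.1 s).trans_eq h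
      have h2 : 0 < (1 + ‖(s : ℂ)‖) ^ (l : ℝ) := by positivity
      have h3 : ‖f.fn s‖ ≤ 0 := by simpa using (div_le_iff₀ h2).1 h1
      exact norm_le_zero_iff.1 h3
    · rintro rfl
      exact le_antisymm (growthNorm_le fun s => by
        show ‖(0 : ℂ)‖ / _ ≤ 0
        simp) (growthNorm_nonneg l _)

noncomputable instance (lam : Frequency) (l : ℝ≥0) : NormedAddCommGroup (RieszHSpace lam l) :=
  NormedAddCommGroup.ofCore (RieszHSpace.core lam l)

noncomputable instance (lam : Frequency) (l : ℝ≥0) : NormedSpace ℂ (RieszHSpace lam l) :=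
  NormedSpace.ofCore (RieszHSpace.core lam l)

/-! The spaces of Dirichlet series. -/

/-- `f` is the limit function on the right half-plane of the Riesz means of order `l` of the
Dirichlet series with coefficients `a`. -/
def IsLimitFunction (lam : Frequency) (l : ℝ≥0) (a : ℕ → ℂ) (f : RightHalfPlane → ℂ) : Prop :=
  ∀ s : RightHalfPlane, Tendsto (fun x : ℝ => rieszMean lam l a x s) atTop (𝓝 (f s))

theorem IsLimitFunction.unique {lam : Frequency} {l : ℝ≥0} {a : ℕ → ℂ}
    {f g : RightHalfPlane → ℂ} (hf : IsLimitFunction lam l a f) (hg : IsLimitFunction lam l a g) :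
    f = g :=
  funext fun s => tendsto_nhds_unique (hf s) (hg s)

theorem IsLimitFunction.add {lam : Frequency} {l : ℝ≥0} {a b : ℕ → ℂ}
    {f g : RightHalfPlane → ℂ} (hf : IsLimitFunction lam l a f) (hg : IsLimitFunction lam l b g) :
    IsLimitFunction lam l (a + b) (f + g) := fun s => by
  simpa only [rieszMean_add, Pi.add_apply] using (hf s).add (hg s)

theorem IsLimitFunction.smul {lam : Frequency} {l : ℝ≥0} {a : ℕ → ℂ}
    {f : RightHalfPlane → ℂ} (c : ℂ) (hf : IsLimitFunction lam l a f) :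
    IsLimitFunction lam l (c • a) (c • f) := fun s => by
  simpa only [rieszMean_smul, Pi.smul_apply, smul_eq_mul] using (hf s).const_mul c

/-- The linear space `D_{∞,l}(lam)` of all Dirichlet series (given by their coefficients) that are
`(lam, l)`-Riesz summable on the right half-plane with limit function in
`H_{∞,l}^lam[Re > 0]`. -/
def DSubmodule (lam : Frequency) (l : ℝ≥0) : Submodule ℂ (ℕ → ℂ) where
  carrier := {a | ∃ f ∈ HSubmodule lam l, IsLimitFunction lam l a f}
  add_mem' := by
    rintro a b ⟨f, hf, hf'⟩ ⟨g, hg, hg'⟩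
    exact ⟨f + g, (HSubmodule lam l).add_mem hf hg, hf'.add hg'⟩
  zero_mem' := ⟨0, (HSubmodule lam l).zero_mem, fun s => by simp [rieszMean_zero]⟩
  smul_mem' := by
    rintro c a ⟨f, hf, hf'⟩
    exact ⟨c • f, (HSubmodule lam l).smul_mem c hf, hf'.smul c⟩

/-- `D_{∞,l}(lam)` as a type, which carries the norm of the limit function (and not the topology
of coefficientwise convergence). -/
def RieszDSpace (lam : Frequency) (l : ℝ≥0) : Type := DSubmodule lam l

noncomputable instance (lam : Frequency) (l : ℝ≥0) : AddCommGroup (RieszDSpace lam l) :=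
  inferInstanceAs (AddCommGroup (DSubmodule lam l))

noncomputable instance (lam : Frequency) (l : ℝ≥0) : Module ℂ (RieszDSpace lam l) :=
  inferInstanceAs (Module ℂ (DSubmodule lam l))

/-- The coefficients of a Dirichlet series in `D_{∞,l}(lam)`. -/
def RieszDSpace.coeff {lam : Frequency} {l : ℝ≥0} (D : RieszDSpace lam l) : ℕ → ℂ := Subtype.val D

/-- The limit function of a Dirichlet series in `D_{∞,l}(lam)`. -/
noncomputable def RieszDSpace.limitFn {lam : Frequency} {l : ℝ≥0} (D : RieszDSpace lam l) : RieszHSpace lam l :=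
  ⟨Classical.choose D.2, (Classical.choose_spec D.2).1⟩

theorem RieszDSpace.limitFn_spec {lam : Frequency} {l : ℝ≥0} (D : RieszDSpace lam l) :
    IsLimitFunction lam l D.coeff D.limitFn.fn :=
  (Classical.choose_spec D.2).2

theorem RieszDSpace.limitFn_eq {lam : Frequency} {l : ℝ≥0} (D : RieszDSpace lam l) (f : RieszHSpace lam l)
    (h : IsLimitFunction lam l D.coeff f.fn) : D.limitFn = f :=
  Subtype.ext (D.limitFn_spec.unique h)

/-- The linear map that sends a Dirichlet series in `D_{∞,l}(lam)` to its limit function. -/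
noncomputable def RieszDSpace.limitMap (lam : Frequency) (l : ℝ≥0) :
    RieszDSpace lam l →ₗ[ℂ] RieszHSpace lam l where
  toFun D := D.limitFn
  map_add' D E := RieszDSpace.limitFn_eq _ _ (D.limitFn_spec.add E.limitFn_spec)
  map_smul' c D := RieszDSpace.limitFn_eq _ _ (D.limitFn_spec.smul c)

/-- The norm on `D_{∞,l}(lam)` is the growth norm of the limit function. -/
noncomputable instance (lam : Frequency) (l : ℝ≥0) : SeminormedAddCommGroup (RieszDSpace lam l) :=
  SeminormedAddCommGroup.induced (RieszDSpace lam l) (RieszHSpace lam l) (RieszDSpace.limitMap lam l)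

noncomputable instance (lam : Frequency) (l : ℝ≥0) : NormedSpace ℂ (RieszDSpace lam l) :=
  NormedSpace.induced ℂ (RieszDSpace lam l) (RieszHSpace lam l) (RieszDSpace.limitMap lam l)

theorem RieszDSpace.norm_def {lam : Frequency} {l : ℝ≥0} (D : RieszDSpace lam l) :
    ‖D‖ = growthNorm l D.limitFn.fn := rfl

/-! Translations. -/

/-- The translation `s ↦ s + u` of the right half-plane. -/
def shiftPoint (u : ℝ≥0) (s : RightHalfPlane) : RightHalfPlane :=
  ⟨(s : ℂ) + (u : ℝ), by
    have h1 := s.2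
    have h2 := u.2
    simp only [Complex.add_re, Complex.ofReal_re]
    exact add_pos_of_pos_of_nonneg h1 h2⟩

/-- The coefficients `a n * exp (-lam n * u)` of the translated Dirichlet series. -/
noncomputable def translateCoeff (lam : Frequency) (u : ℝ≥0) (a : ℕ → ℂ) : ℕ → ℂ :=
  fun n => a n * Complex.exp (-(lam n : ℂ) * (u : ℝ))

theorem rieszMean_translate (lam : Frequency) (k : ℝ) (u : ℝ≥0) (a : ℕ → ℂ) (x : ℝ) (s : ℂ) :
    rieszMean lam k (translateCoeff lam u a) x s = rieszMean lam k a x (s + (u : ℝ)) := by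
  refine Finset.sum_congr rfl fun n _ => ?_
  rw [translateCoeff, mul_assoc (a n), ← Complex.exp_add]
  congr 3
  ring

theorem HSubmodule.translate_mem {lam : Frequency} {l : ℝ≥0} {f : RightHalfPlane → ℂ}
    (hf : f ∈ HSubmodule lam l) (u : ℝ≥0) : f ∘ shiftPoint u ∈ HSubmodule lam l := by
  obtain ⟨⟨F, hF, hFf⟩, hg, a, m, hm, σ, h⟩ := hf
  refine ⟨⟨fun s => F (s + (u : ℝ)), ?_, fun s => hFf (shiftPoint u s)⟩, ?_,
    translateCoeff lam u a, m, hm, σ, fun s hs => ?_⟩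
  · exact hF.comp (by fun_prop) fun s hs => (shiftPoint u ⟨s, hs⟩).2
  · refine HasGrowth.of_le (C := growthNorm l f * (1 + (u : ℝ)) ^ (l : ℝ)) fun s => ?_
    have h1 := (div_le_iff₀ (by positivity)).1 (hg.le (shiftPoint u s))
    have h2 : 1 + ‖((shiftPoint u s : RightHalfPlane) : ℂ)‖
        ≤ (1 + (u : ℝ)) * (1 + ‖(s : ℂ)‖) := by
      have h3 : ‖(s : ℂ) + ((u : ℝ) : ℂ)‖ ≤ ‖(s : ℂ)‖ + u := by
        refine (norm_add_le _ _).trans_eq ?_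
        simp
      have h4 : 0 ≤ (u : ℝ) * ‖(s : ℂ)‖ := by positivity
      show 1 + ‖(s : ℂ) + ((u : ℝ) : ℂ)‖ ≤ _
      linarith
    rw [div_le_iff₀ (by positivity), mul_assoc, ← Real.mul_rpow (by positivity) (by positivity)]
    refine h1.trans (mul_le_mul_of_nonneg_left ?_ (growthNorm_nonneg l f))
    exact Real.rpow_le_rpow (by positivity) h2 l.2
  · simp only [rieszMean_translate]
    refine h (shiftPoint u s) (hs.trans_le ?_)
    simp [shiftPoint]

theorem DSubmodule.translate_mem {lam : Frequency} {l : ℝ≥0} {a : ℕ → ℂ}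
    (ha : a ∈ DSubmodule lam l) (u : ℝ≥0) : translateCoeff lam u a ∈ DSubmodule lam l := by
  obtain ⟨f, hf, h⟩ := ha
  refine ⟨f ∘ shiftPoint u, HSubmodule.translate_mem hf u, fun s => ?_⟩
  simp only [rieszMean_translate]
  exact h (shiftPoint u s)

/-- The translation of a Dirichlet series by `u ≥ 0`, as a self-map of `D_{∞,l}(lam)`. -/
noncomputable def RieszDSpace.translate {lam : Frequency} {l : ℝ≥0} (u : ℝ≥0) (D : RieszDSpace lam l) :
    RieszDSpace lam l :=
  ⟨translateCoeff lam u D.coeff, DSubmodule.translate_mem D.2 u⟩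

/-- Montel's theorem for `D_{∞,l}(lam)`: every bounded sequence has a subsequence, and there is a
Dirichlet series in the space, such that the translations of the subsequence by any `u > 0`
converge in norm to the translation of that series. -/
def SatisfiesMontel (lam : Frequency) (l : ℝ≥0) : Prop :=
  ∀ D : ℕ → RieszDSpace lam l, (∃ C : ℝ, ∀ N, ‖D N‖ ≤ C) →
    ∃ φ : ℕ → ℕ, StrictMono φ ∧ ∃ E : RieszDSpace lam l, ∀ u : ℝ≥0, 0 < u →
      Tendsto (fun j => (D (φ j)).translate u) atTop (𝓝 (E.translate u))

/-! Laplace transforms of powers and the Perron kernel. -/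

/-! The limit map from Dirichlet series to functions is isometric by definition, and injective
because germs are unique. Each of the four conditions says that it is onto. The function space
itself is always complete and always has the Montel property, so surjectivity carries both over to
Dirichlet series. Conversely, translates of any function in the space are norm limits of Dirichlet
polynomials. Completeness or Montel's theorem therefore puts all translates by `u > 0` into the
range, and by uniqueness of germs this makes the germ summable of order `l` at every point.

The unconditional facts come from one formula, `rieszMean_eq_integral`. For a fixed order depending
only on `l`, the Riesz mean at `s` is the average of `F (s + (1 + it) / x)` against a kernel of
total mass one. Cauchy's estimate for the derivative then gives `exists_norm_rieszMean_sub_le`: on a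
translated half-plane the means approach the function at rate `1 / x` in the weighted norm, with a
constant independent of the function. A triangular argument bounds each coefficient by the norm
(`exists_norm_coeff_le`), which gives uniqueness of germs. Uniform approximation by finite sums
turns coefficientwise convergence of a bounded sequence into norm convergence of all its translates
(`exists_tendsto_of_tendsto_coeff`); completeness and Montel's theorem follow.

The obstacle to the formula is that a germ is summable only far to the right, and of an unrelated
order `m`. There the means grow at most like a power of `‖z‖` on vertical lines
(`exists_norm_rieszMean_le`), so dominated convergence proves Perron's formula for high orders.
Differentiating in `x` lowers the order to one governed by the growth of `F` alone, and Cauchy's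
theorem moves the line of integration to real part `1 / x`. -/

theorem integrableOn_pow_mul_cexp (k : ℕ) {z : ℂ} (hz : 0 < z.re) :
    IntegrableOn (fun t : ℝ => (t : ℂ) ^ k * Complex.exp (-z * t)) (Set.Ioi 0) := by
  have h := integrableOn_rpow_mul_exp_neg_mul_rpow (s := k) (p := 1) (b := z.re)
    (by have : (0 : ℝ) ≤ k := Nat.cast_nonneg k
        linarith) one_pos hz
  refine Integrable.mono' h (by fun_prop) ?_
  refine (ae_restrict_iff' measurableSet_Ioi).2 (Eventually.of_forall fun t ht => ?_)
  have ht' : (0 : ℝ) < t := ht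
  rw [norm_mul, norm_pow, Complex.norm_real, Real.norm_of_nonneg ht'.le, Complex.norm_exp,
    Real.rpow_natCast, Real.rpow_one]
  simp

theorem tendsto_pow_mul_cexp (k : ℕ) {z : ℂ} (hz : 0 < z.re) :
    Tendsto (fun t : ℝ => (t : ℂ) ^ k * Complex.exp (-z * t)) atTop (𝓝 0) := by
  rw [tendsto_zero_iff_norm_tendsto_zero]
  refine (tendsto_rpow_mul_exp_neg_mul_atTop_nhds_zero k z.re hz).congr' ?_
  filter_upwards [eventually_gt_atTop (0 : ℝ)] with t ht
  rw [norm_mul, norm_pow, Complex.norm_real, Real.norm_of_nonneg ht.le, Complex.norm_exp,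
    Real.rpow_natCast]
  simp

theorem integral_pow_mul_cexp (k : ℕ) {z : ℂ} (hz : 0 < z.re) :
    ∫ t in Set.Ioi (0 : ℝ), (t : ℂ) ^ k * Complex.exp (-z * t) = (k.factorial : ℂ) / z ^ (k + 1) := by
  have hz0 : z ≠ 0 := by
    rintro rfl
    simp at hz
  have hexp : ∀ t : ℝ, HasDerivAt (fun t : ℝ => Complex.exp (-z * t))
      (Complex.exp (-z * t) * (-z)) t := fun t => by
    have h : HasDerivAt (fun t : ℝ => -z * (t : ℂ)) (-z * 1) t :=
      (Complex.ofRealCLM.hasDerivAt (x := t)).const_mul (-z)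
    simpa using h.cexp
  induction k with
  | zero =>
    have h := integral_Ioi_of_hasDerivAt_of_tendsto
      (f := fun t : ℝ => -(Complex.exp (-z * t)) / z)
      (f' := fun t : ℝ => (t : ℂ) ^ 0 * Complex.exp (-z * t)) (a := 0) (m := 0)
      (by fun_prop) (fun t _ => by
        refine ((hexp t).neg.div_const z).congr_deriv ?_
        field_simp) (integrableOn_pow_mul_cexp 0 hz) (by
        have := ((tendsto_pow_mul_cexp 0 hz).neg.div_const z)
        simpa using this)
    rw [h]
    simp [neg_div]
  | succ k ih =>
    have hpow : ∀ t : ℝ, HasDerivAt (fun t : ℝ => (t : ℂ) ^ (k + 1))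
        ((k + 1 : ℕ) * (t : ℂ) ^ k) t := fun t => by
      have h := (hasDerivAt_pow (k + 1) (t : ℂ)).comp_ofReal
      simpa using h
    have h := integral_Ioi_of_hasDerivAt_of_tendsto
      (f := fun t : ℝ => (t : ℂ) ^ (k + 1) * Complex.exp (-z * t))
      (f' := fun t : ℝ => ((k + 1 : ℕ) : ℂ) * ((t : ℂ) ^ k * Complex.exp (-z * t))
        - z * ((t : ℂ) ^ (k + 1) * Complex.exp (-z * t))) (a := 0) (m := 0)
      (by fun_prop) (fun t _ => by
        refine ((hpow t).mul (hexp t)).congr_deriv ?_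
        ring)
      (((integrableOn_pow_mul_cexp k hz).const_mul _).sub
        ((integrableOn_pow_mul_cexp (k + 1) hz).const_mul _))
      (tendsto_pow_mul_cexp (k + 1) hz)
    rw [integral_sub ((integrableOn_pow_mul_cexp k hz).const_mul _)
        ((integrableOn_pow_mul_cexp (k + 1) hz).const_mul _), integral_const_mul,
      integral_const_mul, ih] at h
    have h2 : z * ∫ t in Set.Ioi (0 : ℝ), (t : ℂ) ^ (k + 1) * Complex.exp (-z * t)
        = ((k + 1 : ℕ) : ℂ) * ((k.factorial : ℂ) / z ^ (k + 1)) := by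
      rw [Complex.ofReal_zero, zero_pow (Nat.succ_ne_zero k), zero_mul, sub_zero] at h
      linear_combination -h
    rw [Nat.factorial_succ, eq_div_iff (pow_ne_zero _ hz0), pow_succ z (k + 1),
      mul_comm (z ^ (k + 1)) z, ← mul_assoc, mul_comm _ z, h2]
    push_cast
    field_simp

/-! Vertical lines. -/

theorem re_vertical (κ τ : ℝ) : ((κ : ℂ) + τ * Complex.I).re = κ := by simp

theorem im_vertical (κ τ : ℝ) : ((κ : ℂ) + τ * Complex.I).im = τ := by simp

theorem vertical_ne_zero {κ : ℝ} (hκ : 0 < κ) (τ : ℝ) : (κ : ℂ) + τ * Complex.I ≠ 0 := by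
  intro h
  have := congrArg Complex.re h
  simp at this
  exact hκ.ne' this

theorem le_norm_vertical (κ τ : ℝ) : κ ≤ ‖(κ : ℂ) + τ * Complex.I‖ := by
  simpa using Complex.re_le_norm ((κ : ℂ) + τ * Complex.I)

/-- Powers of order at least two decay quadratically in right half-planes. -/
theorem inv_norm_pow_le {κ : ℝ} (hκ : 0 < κ) {w : ℂ} (hw : κ ≤ w.re) (n : ℕ) :
    (‖w‖ ^ (n + 2))⁻¹ ≤ (κ ^ n)⁻¹ * (1 + (κ ^ 2)⁻¹) * (1 + w.im ^ 2)⁻¹ := by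
  have hn : κ ≤ ‖w‖ := hw.trans (Complex.re_le_norm w)
  have h0 : 0 < ‖w‖ := hκ.trans_le hn
  have h1 : 1 + w.im ^ 2 ≤ (1 + (κ ^ 2)⁻¹) * ‖w‖ ^ 2 := by
    have e : ‖w‖ ^ 2 = w.re ^ 2 + w.im ^ 2 := by
      rw [Complex.sq_norm, Complex.normSq_apply]
      ring
    have e2 : 1 ≤ (κ ^ 2)⁻¹ * ‖w‖ ^ 2 := by
      rw [inv_mul_eq_div, one_le_div (by positivity)]
      gcongr
    nlinarith [sq_nonneg w.re]
  rw [pow_add, mul_inv, mul_assoc]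
  refine mul_le_mul (inv_anti₀ (by positivity) (pow_le_pow_left₀ hκ.le hn n)) ?_ (by positivity)
    (by positivity)
  rw [← div_eq_mul_inv, le_div_iff₀ (by positivity), inv_mul_eq_div, div_le_iff₀ (by positivity)]
  exact h1

theorem continuous_cexp_div_pow (x : ℝ) {κ : ℝ} (hκ : 0 < κ) (n : ℕ) :
    Continuous fun τ : ℝ => Complex.exp (x * ((κ : ℂ) + τ * Complex.I))
      / ((κ : ℂ) + τ * Complex.I) ^ n :=
  Continuous.div (by fun_prop) (by fun_prop) fun τ => pow_ne_zero _ (vertical_ne_zero hκ τ)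

theorem norm_cexp_vertical (x κ τ : ℝ) :
    ‖Complex.exp (x * ((κ : ℂ) + τ * Complex.I))‖ = Real.exp (x * κ) := by
  rw [Complex.norm_exp]
  simp

theorem integrable_cexp_div_pow (x : ℝ) {κ : ℝ} (hκ : 0 < κ) (n : ℕ) :
    Integrable fun τ : ℝ => Complex.exp (x * ((κ : ℂ) + τ * Complex.I))
      / ((κ : ℂ) + τ * Complex.I) ^ (n + 2) := by
  refine Integrable.mono' (integrable_inv_one_add_sq.const_mul
    (Real.exp (x * κ) * ((κ ^ n)⁻¹ * (1 + (κ ^ 2)⁻¹))))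
    (continuous_cexp_div_pow x hκ _).aestronglyMeasurable (Eventually.of_forall fun τ => ?_)
  rw [norm_div, norm_cexp_vertical, norm_pow, div_eq_mul_inv, mul_assoc (Real.exp _)]
  have h := inv_norm_pow_le hκ (re_vertical κ τ).ge n
  rw [im_vertical] at h
  exact mul_le_mul_of_nonneg_left h (Real.exp_pos _).le

/-- The Perron kernel: the inverse Laplace transform of `z ^ (-(k + 1))`. -/
theorem integral_cexp_div_pow (x : ℝ) {κ : ℝ} (hκ : 0 < κ) {k : ℕ} (hk : 1 ≤ k) :
    ∫ τ : ℝ, Complex.exp (x * ((κ : ℂ) + τ * Complex.I)) / ((κ : ℂ) + τ * Complex.I) ^ (k + 1)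
      = 2 * Real.pi * ((max x 0 ^ k / k.factorial : ℝ) : ℂ) := by
  obtain ⟨n, rfl⟩ : ∃ n, k = n + 1 := ⟨k - 1, by omega⟩
  -- The Fourier transform of this function at `ξ` is the Laplace transform of the power at `κ +
  -- 2πiξ`, so the claim is Fourier inversion at `x`. The condition `k ≥ 1` makes `g` continuous and
  -- its transform integrable.
  set g : ℝ → ℂ := fun t => ((max t 0 : ℝ) : ℂ) ^ (n + 1) * Complex.exp (-(κ : ℂ) * t) with hg
  have hgc : Continuous g := by fun_prop
  have hg0 : ∀ t : ℝ, t ∉ Set.Ioi (0 : ℝ) → g t = 0 := fun t ht => by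
    have ht' : t ≤ 0 := not_lt.1 ht
    simp [hg, max_eq_right ht']
  have hgi : Integrable g := by
    rw [← integrableOn_iff_integrable_of_support_subset
      (s := Set.Ioi 0) (fun t ht => by_contra fun h => ht (hg0 t h))]
    refine (integrableOn_pow_mul_cexp (n + 1) (z := κ) (by simpa using hκ)).congr_fun
      (fun t ht => ?_) measurableSet_Ioi
    have ht' : 0 < t := ht
    simp [hg, max_eq_left ht'.le]
  have hF : ∀ ξ : ℝ, FourierTransform.fourier g ξ = ((n + 1).factorial : ℂ)
      / ((κ : ℂ) + ((2 * Real.pi * ξ : ℝ) : ℂ) * Complex.I) ^ (n + 2) := by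
    intro ξ
    rw [Real.fourier_eq', ← integral_pow_mul_cexp (n + 1) (by simpa using hκ),
      ← setIntegral_eq_integral_of_forall_compl_eq_zero (s := Set.Ioi 0)
        (fun t ht => by rw [hg0 t ht, smul_zero])]
    refine setIntegral_congr_fun measurableSet_Ioi fun t ht => ?_
    simp only [hg, max_eq_left (le_of_lt (Set.mem_Ioi.1 ht)), smul_eq_mul]
    rw [mul_left_comm, ← Complex.exp_add]
    congr 2
    simp
    ring
  have hpi : (0 : ℝ) < 2 * Real.pi := by positivity
  have hFi : Integrable (FourierTransform.fourier g) := by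
    have h := ((integrable_cexp_div_pow 0 hκ n).const_mul ((n + 1).factorial : ℂ)).comp_mul_left'
      hpi.ne'
    refine h.congr (Eventually.of_forall fun ξ => ?_)
    simp only [hF]
    simp [div_eq_mul_inv]
  have hinv := congrFun (hgc.fourierInv_fourier_eq hgi hFi) x
  rw [Real.fourierInv_eq'] at hinv
  set G : ℝ → ℂ := fun τ => Complex.exp (x * ((κ : ℂ) + τ * Complex.I))
    / ((κ : ℂ) + τ * Complex.I) ^ (n + 1 + 1) with hG
  have hpt : ∀ ξ : ℝ, Complex.exp (((2 * Real.pi * inner ℝ ξ x : ℝ) : ℂ) * Complex.I)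
      • FourierTransform.fourier g ξ
      = ((n + 1).factorial : ℂ) * Complex.exp (-(κ : ℂ) * x) * G (2 * Real.pi * ξ) := by
    intro ξ
    rw [hF, hG, smul_eq_mul]
    have : Complex.exp (((2 * Real.pi * inner ℝ ξ x : ℝ) : ℂ) * Complex.I)
        = Complex.exp (-(κ : ℂ) * x)
          * Complex.exp (x * ((κ : ℂ) + ((2 * Real.pi * ξ : ℝ) : ℂ) * Complex.I)) := by
      rw [← Complex.exp_add]
      congr 1
      simp
      ring
    rw [this]
    ring
  rw [integral_congr_ae (Eventually.of_forall hpt), integral_const_mul,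
    Measure.integral_comp_mul_left, abs_of_pos (inv_pos.2 hpi)] at hinv
  have hf : ((n + 1).factorial : ℂ) ≠ 0 := by exact_mod_cast (n + 1).factorial_ne_zero
  have he : Complex.exp (-(κ : ℂ) * x) ≠ 0 := Complex.exp_ne_zero _
  have hpc : (Real.pi : ℂ) ≠ 0 := by exact_mod_cast Real.pi_ne_zero
  rw [Complex.real_smul, hg] at hinv
  push_cast at hinv ⊢
  field_simp at hinv ⊢
  linear_combination hinv

/-! Shifting vertical lines of integration. -/

/-- Cauchy's theorem on the rectangles of height `2T`: the quadratic decay makes the horizontal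
sides vanish as `T → ∞` and the line integrals converge absolutely. -/
theorem integral_vertical_eq {h : ℂ → ℂ} {κ₁ κ₂ C : ℝ} (h12 : κ₁ ≤ κ₂)
    (hd : DifferentiableOn ℂ h {w | κ₁ ≤ w.re ∧ w.re ≤ κ₂})
    (hb : ∀ w : ℂ, κ₁ ≤ w.re → w.re ≤ κ₂ → ‖h w‖ ≤ C * (1 + w.im ^ 2)⁻¹) :
    ∫ τ : ℝ, h ((κ₁ : ℂ) + τ * Complex.I) = ∫ τ : ℝ, h ((κ₂ : ℂ) + τ * Complex.I) := by
  have hi : ∀ κ : ℝ, κ₁ ≤ κ → κ ≤ κ₂ → Integrable fun τ : ℝ => h ((κ : ℂ) + τ * Complex.I) := by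
    intro κ h1 h2
    refine Integrable.mono' (integrable_inv_one_add_sq.const_mul C) ?_
      (Eventually.of_forall fun τ => ?_)
    · have : Continuous fun τ : ℝ => h ((κ : ℂ) + τ * Complex.I) :=
        hd.continuousOn.comp_continuous (by fun_prop) fun τ => by simp [h1, h2]
      exact this.aestronglyMeasurable
    · simpa using hb ((κ : ℂ) + τ * Complex.I) (by simpa using h1) (by simpa using h2)
  have hrect : ∀ T : ℝ, (∫ τ in (-T)..T, h ((κ₂ : ℂ) + τ * Complex.I))
      - (∫ τ in (-T)..T, h ((κ₁ : ℂ) + τ * Complex.I))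
      = Complex.I * ((∫ y in κ₁..κ₂, h (y + ((-T : ℝ) : ℂ) * Complex.I))
        - ∫ y in κ₁..κ₂, h (y + (T : ℂ) * Complex.I)) := by
    intro T
    have hr := Complex.integral_boundary_rect_eq_zero_of_differentiableOn h
      ((κ₁ : ℂ) + ((-T : ℝ) : ℂ) * Complex.I) ((κ₂ : ℂ) + T * Complex.I)
      (hd.mono fun w hw => by
        have := hw.1
        simpa [Set.uIcc_of_le h12] using this)
    simp only [re_vertical, im_vertical, smul_eq_mul] at hr
    linear_combination (-Complex.I) * hr + ((∫ τ in (-T)..T, h ((κ₂ : ℂ) + τ * Complex.I))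
      - (∫ τ in (-T)..T, h ((κ₁ : ℂ) + τ * Complex.I))) * Complex.I_sq
  have hside : ∀ T : ℝ, ‖∫ y in κ₁..κ₂, h (y + (T : ℂ) * Complex.I)‖
      ≤ C * (1 + T ^ 2)⁻¹ * (κ₂ - κ₁) := by
    intro T
    rw [← abs_of_nonneg (sub_nonneg.2 h12)]
    refine intervalIntegral.norm_integral_le_of_norm_le_const fun y hy => ?_
    rw [Set.uIoc_of_le h12] at hy
    simpa using hb (y + T * Complex.I) (by simpa using hy.1.le) (by simpa using hy.2)
  have hdec : Tendsto (fun T : ℝ => C * (1 + T ^ 2)⁻¹ * (κ₂ - κ₁)) atTop (𝓝 0) := by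
    have : Tendsto (fun T : ℝ => (1 + T ^ 2)⁻¹) atTop (𝓝 0) :=
      (tendsto_atTop_add_const_left _ 1 (tendsto_pow_atTop two_ne_zero)).inv_tendsto_atTop
    simpa using (this.const_mul C).mul_const (κ₂ - κ₁)
  have hT : Tendsto (fun T : ℝ => ∫ y in κ₁..κ₂, h (y + (T : ℂ) * Complex.I)) atTop (𝓝 0) :=
    squeeze_zero_norm hside hdec
  have hT' : Tendsto (fun T : ℝ => ∫ y in κ₁..κ₂, h (y + ((-T : ℝ) : ℂ) * Complex.I))
      atTop (𝓝 0) :=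
    squeeze_zero_norm (fun T => hside (-T)) (by simpa using hdec)
  have hlim := (intervalIntegral_tendsto_integral (hi κ₂ h12 le_rfl) tendsto_neg_atTop_atBot
    tendsto_id).sub
    (intervalIntegral_tendsto_integral (hi κ₁ le_rfl h12) tendsto_neg_atTop_atBot tendsto_id)
  have hlim' := ((hT'.sub hT).const_mul Complex.I).congr fun T => (hrect T).symm
  have := tendsto_nhds_unique hlim hlim'
  simp at this
  exact (sub_eq_zero.1 this).symm

/-! Riesz means as sums of truncated powers. -/

/-- The truncation at zero kills all terms with `lam n ≥ x`, so the index set no longer depends on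
`x`. The mean becomes a function of `x` that can be integrated and differentiated term by term on
`(0, y]`. -/
theorem pow_mul_rieszMean (lam : Frequency) {m : ℕ} (hm : 1 ≤ m) (a : ℕ → ℂ) (s : ℂ) {x y : ℝ}
    (hx : 0 < x) (hxy : x ≤ y) :
    (x : ℂ) ^ m * rieszMean lam m a x s
      = ∑ n ∈ lam.below y, a n * Complex.exp (-(lam n : ℂ) * s)
          * ((max (x - lam n) 0 ^ m : ℝ) : ℂ) := by
  rw [rieszMean, Finset.mul_sum]
  have hsub : lam.below x ⊆ lam.below y := fun n hn => by
    rw [Frequency.mem_below] at hn ⊢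
    linarith
  refine Finset.sum_subset_zero_on_sdiff hsub (fun n hn => ?_) (fun n hn => ?_)
  · have h1 : ¬ lam n < x := by
      have := (Finset.mem_sdiff.1 hn).2
      rwa [Frequency.mem_below] at this
    rw [max_eq_right (by linarith), zero_pow (by omega)]
    simp
  · rw [Frequency.mem_below] at hn
    rw [max_eq_left (by linarith), Real.rpow_natCast]
    have : x - lam n = x * (1 - lam n / x) := by field_simp
    rw [this, mul_pow]
    push_cast
    ring

/-! The operator of integration from `0` on continuous functions. -/

/-- Integration from `0`, as an operator on continuous functions. -/
noncomputable def primitiveMap : C(ℝ, ℂ) →ₗ[ℂ] C(ℝ, ℂ) where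
  toFun g := ⟨fun t => ∫ u in (0 : ℝ)..t, g u,
    intervalIntegral.continuous_primitive (fun _ _ => g.continuous.intervalIntegrable _ _) 0⟩
  map_add' g h := by
    ext t
    exact intervalIntegral.integral_add (g.continuous.intervalIntegrable _ _)
      (h.continuous.intervalIntegrable _ _)
  map_smul' c g := by
    ext t
    exact intervalIntegral.integral_smul c g

theorem primitiveMap_apply (g : C(ℝ, ℂ)) (t : ℝ) : primitiveMap g t = ∫ u in (0 : ℝ)..t, g u := rfl

/-- The fundamental theorem of calculus tolerates a countable exceptional set, so the kink at `lam`
does no harm as long as both functions are continuous. -/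
theorem primitiveMap_eq_of_piecewise {G g : C(ℝ, ℂ)} {G₁ g₁ : ℝ → ℂ} (lam : ℝ) (h0 : G 0 = 0)
    (hl : ∀ t < lam, G t = 0 ∧ g t = 0) (hr : ∀ t, lam < t → G t = G₁ t ∧ g t = g₁ t)
    (hd : ∀ t, HasDerivAt G₁ (g₁ t) t) : primitiveMap g = G := by
  ext t
  rw [primitiveMap_apply, integral_eq_of_hasDerivAt_off_countable G g
    (Set.countable_singleton lam) G.continuous.continuousOn (fun x hx => ?_)
    (g.continuous.intervalIntegrable _ _), h0, sub_zero]
  have hne : x ≠ lam := hx.2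
  rcases hne.lt_or_gt with h | h
  · rw [(hl x h).2]
    refine (hasDerivAt_const x (0 : ℂ)).congr_of_eventuallyEq ?_
    filter_upwards [Iio_mem_nhds h] with y hy using (hl y hy).1
  · rw [(hr x h).2]
    refine (hd x).congr_of_eventuallyEq ?_
    filter_upwards [Ioi_mem_nhds h] with y hy using (hr y hy).1

/-- The operator `g ↦ g + z * ∫ g`. -/
noncomputable def resolventMap (z : ℂ) : Module.End ℂ C(ℝ, ℂ) := 1 + z • primitiveMap

theorem resolventMap_apply (z : ℂ) (g : C(ℝ, ℂ)) :
    resolventMap z g = g + z • primitiveMap g := rfl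

theorem commute_resolventMap (z : ℂ) (n : ℕ) :
    Commute (resolventMap z ^ n) (primitiveMap : Module.End ℂ C(ℝ, ℂ)) :=
  Commute.pow_left ((Commute.one_left _).add_left ((Commute.refl _).smul_left z)) n

/-! ### Truncated powers and the resolvent identity. -/

/-- The truncated power `t ↦ (t - lam)₊ ^ m / m!`. -/
noncomputable def truncPow (m : ℕ) (lam : ℝ) : C(ℝ, ℂ) :=
  ⟨fun t => ((max (t - lam) 0 ^ m / m.factorial : ℝ) : ℂ), by fun_prop⟩

theorem truncPow_apply (m : ℕ) (lam t : ℝ) :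
    truncPow m lam t = ((max (t - lam) 0 ^ m / m.factorial : ℝ) : ℂ) := rfl

theorem truncPow_of_le {m : ℕ} (hm : 1 ≤ m) {lam t : ℝ} (h : t ≤ lam) : truncPow m lam t = 0 := by
  rw [truncPow_apply, max_eq_right (by linarith), zero_pow (by omega)]
  simp

theorem truncPow_of_ge (m : ℕ) {lam t : ℝ} (h : lam ≤ t) :
    truncPow m lam t = ((t : ℂ) - lam) ^ m / m.factorial := by
  rw [truncPow_apply, max_eq_left (by linarith)]
  push_cast
  rfl

/-- Multiplication by `exp (-z * t)`. -/
noncomputable def twist (z : ℂ) : C(ℝ, ℂ) →ₗ[ℂ] C(ℝ, ℂ) where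
  toFun g := ⟨fun t => Complex.exp (-z * t) * g t, by fun_prop⟩
  map_add' g h := by
    ext t
    exact mul_add _ _ _
  map_smul' c g := by
    ext t
    exact mul_left_comm _ _ _

theorem twist_apply (z : ℂ) (g : C(ℝ, ℂ)) (t : ℝ) :
    twist z g t = Complex.exp (-z * t) * g t := rfl

theorem hasDerivAt_cexp_mul (z : ℂ) (t : ℝ) :
    HasDerivAt (fun t : ℝ => Complex.exp (-z * t)) (-z * Complex.exp (-z * t)) t := by
  have h : HasDerivAt (fun t : ℝ => -z * (t : ℂ)) (-z * 1) t :=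
    (Complex.ofRealCLM.hasDerivAt (x := t)).const_mul (-z)
  simpa [mul_comm] using h.cexp

theorem hasDerivAt_sub_pow_div (m : ℕ) (lam : ℂ) (t : ℝ) :
    HasDerivAt (fun t : ℝ => ((t : ℂ) - lam) ^ (m + 1) / (m + 1).factorial)
      (((t : ℂ) - lam) ^ m / m.factorial) t := by
  have h := (((hasDerivAt_id (t : ℂ)).sub_const lam).pow (m + 1)).comp_ofReal.div_const
    ((m + 1).factorial : ℂ)
  refine h.congr_deriv ?_
  have h1 : (m.factorial : ℂ) ≠ 0 := by exact_mod_cast m.factorial_ne_zero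
  have h2 : (m + 1 : ℂ) ≠ 0 := by exact_mod_cast m.succ_ne_zero
  rw [Nat.factorial_succ]
  push_cast
  simp only [id]
  field_simp

theorem primitiveMap_truncPow {m : ℕ} (hm : 1 ≤ m) {lam : ℝ} (hl : 0 ≤ lam) :
    primitiveMap (truncPow m lam) = truncPow (m + 1) lam :=
  primitiveMap_eq_of_piecewise lam (truncPow_of_le (by omega) hl)
    (fun _ ht => ⟨truncPow_of_le (by omega) ht.le, truncPow_of_le hm ht.le⟩)
    (fun _ ht => ⟨truncPow_of_ge _ ht.le, truncPow_of_ge _ ht.le⟩)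
    (hasDerivAt_sub_pow_div m lam)

/-- The product rule, integrated: `exp (-zt) T_{m+1}` has derivative `exp (-zt) T_m - z exp (-zt)
T_{m+1}`, where `T_m` is the truncated power. -/
theorem resolventMap_twist_truncPow_succ (z : ℂ) {m : ℕ} (hm : 1 ≤ m) {lam : ℝ} (hl : 0 ≤ lam) :
    resolventMap z (twist z (truncPow (m + 1) lam)) = primitiveMap (twist z (truncPow m lam)) := by
  have h : primitiveMap (twist z (truncPow m lam) - z • twist z (truncPow (m + 1) lam))
      = twist z (truncPow (m + 1) lam) := by
    refine primitiveMap_eq_of_piecewise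
      (G₁ := fun t => Complex.exp (-z * t) * (((t : ℂ) - lam) ^ (m + 1) / (m + 1).factorial))
      (g₁ := fun t => Complex.exp (-z * t) * (((t : ℂ) - lam) ^ m / m.factorial)
        - z * (Complex.exp (-z * t) * (((t : ℂ) - lam) ^ (m + 1) / (m + 1).factorial)))
      lam ?_ (fun t ht => ?_) (fun t ht => ?_) fun t => ?_
    · rw [twist_apply, truncPow_of_le (by omega) hl, mul_zero]
    · simp [twist_apply, truncPow_of_le hm ht.le, truncPow_of_le (Nat.le_add_left 1 m) ht.le]
    · simp [twist_apply, truncPow_of_ge _ ht.le]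
    · refine ((hasDerivAt_cexp_mul z t).mul (hasDerivAt_sub_pow_div m lam t)).congr_deriv ?_
      ring
  rw [map_sub, map_smul] at h
  rw [resolventMap_apply, ← eq_sub_iff_add_eq]
  exact h.symm

/-- This starts the induction at `m = 1` because the truncated power of order zero is not continuous
and lies outside the space. -/
theorem resolventMap_sq_twist_truncPow_one {z : ℂ} (hz : z ≠ 0) {lam : ℝ} (hl : 0 ≤ lam) :
    (resolventMap z ^ 2) (twist z (truncPow 1 lam)) = Complex.exp (-z * lam) • truncPow 1 lam := by
  -- The integral of `exp (-zu)` from `lam` to `max t lam`, that is, the primitive of the missing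
  -- twisted step function. It is the result of the first application of the operator.
  set E : C(ℝ, ℂ) := ⟨fun t => (Complex.exp (-z * lam) - Complex.exp (-z * (max t lam : ℝ))) / z,
    by fun_prop⟩ with hE
  have hE_le : ∀ t ≤ lam, E t = 0 := fun t ht => by simp [hE, max_eq_right ht]
  have hE_ge : ∀ t, lam ≤ t → E t = (Complex.exp (-z * lam) - Complex.exp (-z * t)) / z :=
    fun t ht => by simp [hE, max_eq_left ht]
  have hEd : ∀ t : ℝ, HasDerivAt
      (fun t : ℝ => (Complex.exp (-z * lam) - Complex.exp (-z * t)) / z)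
      (Complex.exp (-z * t)) t := fun t => by
    refine (((hasDerivAt_cexp_mul z t).const_sub _).div_const z).congr_deriv ?_
    field_simp
  have h1d : ∀ t : ℝ, HasDerivAt (fun t : ℝ => (t : ℂ) - lam) 1 t := fun t =>
    ((hasDerivAt_id (t : ℂ)).sub_const (lam : ℂ)).comp_ofReal
  have hT : ∀ t, lam ≤ t → truncPow 1 lam t = (t : ℂ) - lam := fun t ht => by
    simp [truncPow_of_ge 1 ht]
  have h1 : primitiveMap (z • twist z (truncPow 1 lam)) = E - twist z (truncPow 1 lam) := by
    refine primitiveMap_eq_of_piecewise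
      (G₁ := fun t => (Complex.exp (-z * lam) - Complex.exp (-z * t)) / z
        - Complex.exp (-z * t) * ((t : ℂ) - lam))
      (g₁ := fun t => z * (Complex.exp (-z * t) * ((t : ℂ) - lam)))
      lam ?_ (fun t ht => ?_) (fun t ht => ?_) fun t => ?_
    · simp [twist_apply, truncPow_of_le le_rfl hl, hE_le 0 hl]
    · simp [twist_apply, truncPow_of_le le_rfl ht.le, hE_le t ht.le]
    · simp [twist_apply, hT t ht.le, hE_ge t ht.le]
    · refine ((hEd t).sub ((hasDerivAt_cexp_mul z t).mul (h1d t))).congr_deriv ?_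
      ring
  have h2 : primitiveMap (z • E) = Complex.exp (-z * lam) • truncPow 1 lam - E := by
    refine primitiveMap_eq_of_piecewise
      (G₁ := fun t => Complex.exp (-z * lam) * ((t : ℂ) - lam)
        - (Complex.exp (-z * lam) - Complex.exp (-z * t)) / z)
      (g₁ := fun t => z * ((Complex.exp (-z * lam) - Complex.exp (-z * t)) / z))
      lam ?_ (fun t ht => ?_) (fun t ht => ?_) fun t => ?_
    · simp [truncPow_of_le le_rfl hl, hE_le 0 hl]
    · simp [truncPow_of_le le_rfl ht.le, hE_le t ht.le]
    · simp [hT t ht.le, hE_ge t ht.le]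
    · refine (((h1d t).const_mul _).sub (hEd t)).congr_deriv ?_
      field_simp
  rw [map_smul] at h1 h2
  have h3 : resolventMap z (twist z (truncPow 1 lam)) = E := by
    rw [resolventMap_apply, h1]
    abel
  rw [pow_two, Module.End.mul_apply, h3, resolventMap_apply, h2]
  abel

/-- In terms of Laplace transforms in a variable `q`, the truncated power is `exp (-lam q) / q ^ (m
+ 1)`, the twist replaces `q` by `q + z`, and the operator multiplies by `(q + z) / q`. Its power `m
+ 1` restores the denominator and leaves the factor `exp (-z lam)`. By linearity this carries a
Riesz sum at `c` to the one at `c + z`, with no reference to the coefficients. -/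
theorem resolventMap_pow_twist_truncPow {z : ℂ} (hz : z ≠ 0) {lam : ℝ} (hl : 0 ≤ lam) {m : ℕ}
    (hm : 1 ≤ m) :
    (resolventMap z ^ (m + 1)) (twist z (truncPow m lam))
      = Complex.exp (-z * lam) • truncPow m lam := by
  induction m, hm using Nat.le_induction with
  | base => exact resolventMap_sq_twist_truncPow_one hz hl
  | succ m hm ih =>
    have hc := congrArg (fun T : Module.End ℂ C(ℝ, ℂ) => T (twist z (truncPow m lam)))
      (commute_resolventMap z (m + 1)).eq
    simp only [Module.End.mul_apply] at hc
    rw [pow_succ, Module.End.mul_apply, resolventMap_twist_truncPow_succ z hm hl, hc, ih, map_smul,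
      primitiveMap_truncPow hm hl]

/-! ### Polynomial growth of Riesz means on vertical lines. -/

theorem norm_resolventMap_le (z : ℂ) {g : C(ℝ, ℂ)} {K Y : ℝ} {j : ℕ} (hK : 0 ≤ K)
    (hg : ∀ t, 0 ≤ t → t ≤ Y → ‖g t‖ ≤ K * (1 + t) ^ j) :
    ∀ t, 0 ≤ t → t ≤ Y → ‖resolventMap z g t‖ ≤ K * (1 + ‖z‖) * (1 + t) ^ (j + 1) := by
  intro t ht htY
  have h1 : ‖primitiveMap g t‖ ≤ K * (1 + t) ^ j * |t - 0| := by
    rw [primitiveMap_apply]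
    refine intervalIntegral.norm_integral_le_of_norm_le_const fun u hu => ?_
    rw [Set.uIoc_of_le ht] at hu
    refine (hg u hu.1.le (hu.2.trans htY)).trans ?_
    have := hu.1
    have := hu.2
    gcongr
  rw [sub_zero, abs_of_nonneg ht] at h1
  have h2 : ‖resolventMap z g t‖ ≤ ‖g t‖ + ‖z‖ * ‖primitiveMap g t‖ := by
    rw [resolventMap_apply]
    exact (norm_add_le _ _).trans_eq (by simp)
  have h3 := hg t ht htY
  have h4 : ‖z‖ * ‖primitiveMap g t‖ ≤ ‖z‖ * (K * (1 + t) ^ j * t) := by gcongr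
  have h5 : 0 ≤ K * (1 + t) ^ j := by positivity
  have h6 : 0 ≤ K * (1 + t) ^ j * ‖z‖ := by positivity
  have h7 : 0 ≤ K * (1 + t) ^ j * t := by positivity
  rw [pow_succ]
  nlinarith

/-- The first integration meets exponential decay and stays bounded; only the other `j` cost a
factor `1 + t` each. The degree `j` in `t`, rather than `j + 1`, is what matches the factor `y ^ m`
of a Riesz mean of order `m`. -/
theorem norm_resolventMap_pow_le (z : ℂ) {g : C(ℝ, ℂ)} {K Y δ : ℝ} (hK : 0 ≤ K) (hδ : 0 < δ)
    (hg : ∀ t, 0 ≤ t → t ≤ Y → ‖g t‖ ≤ K * Real.exp (-δ * t)) (j : ℕ) :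
    ∀ t, 0 ≤ t → t ≤ Y →
      ‖(resolventMap z ^ (j + 1)) g t‖ ≤ K * (1 + δ⁻¹) * (1 + ‖z‖) ^ (j + 1) * (1 + t) ^ j := by
  induction j with
  | zero =>
    intro t ht htY
    have h1 : ‖primitiveMap g t‖ ≤ K * δ⁻¹ := by
      rw [primitiveMap_apply]
      have hi : ∫ u in (0 : ℝ)..t, K * Real.exp (-δ * u) = K * (δ⁻¹ * (1 - Real.exp (-δ * t))) := by
        rw [intervalIntegral.integral_const_mul]
        congr 1
        have hd : ∀ u ∈ Set.uIcc 0 t, HasDerivAt (fun u => -δ⁻¹ * Real.exp (-δ * u))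
            (Real.exp (-δ * u)) u := fun u _ => by
          have h : HasDerivAt (fun u : ℝ => -δ * u) (-δ) u := by
            simpa using (hasDerivAt_id u).const_mul (-δ)
          refine (h.exp.const_mul _).congr_deriv ?_
          field_simp
        rw [intervalIntegral.integral_eq_sub_of_hasDerivAt hd
          (Continuous.intervalIntegrable (by fun_prop) _ _)]
        simp
        ring
      refine (intervalIntegral.norm_integral_le_of_norm_le ht (Eventually.of_forall fun u hu =>
        hg u hu.1.le (hu.2.trans htY)) (Continuous.intervalIntegrable (by fun_prop) _ _)).trans ?_
      rw [hi]
      have := Real.exp_pos (-δ * t)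
      gcongr
      have : 0 < δ⁻¹ := by positivity
      nlinarith
    have h2 : ‖resolventMap z g t‖ ≤ ‖g t‖ + ‖z‖ * ‖primitiveMap g t‖ := by
      rw [resolventMap_apply]
      exact (norm_add_le _ _).trans_eq (by simp)
    have h3 : ‖g t‖ ≤ K := by
      refine (hg t ht htY).trans (mul_le_of_le_one_right hK (Real.exp_le_one_iff.2 ?_))
      nlinarith
    have h4 : ‖z‖ * ‖primitiveMap g t‖ ≤ ‖z‖ * (K * δ⁻¹) := by gcongr
    have h5 : 0 ≤ K * δ⁻¹ := by positivity
    have h6 : 0 ≤ K * ‖z‖ := by positivity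
    simp only [zero_add, pow_one, pow_zero, mul_one]
    nlinarith
  | succ j ih =>
    intro t ht htY
    have h := norm_resolventMap_le z (by positivity) ih t ht htY
    rw [pow_succ', Module.End.mul_apply]
    refine h.trans_eq ?_
    ring

/-- Riesz means that are bounded at one point grow at most polynomially on vertical lines to the
right of it. -/
theorem exists_norm_rieszMean_le (lam : Frequency) {m : ℕ} (hm : 1 ≤ m) (a : ℕ → ℂ) (c : ℂ)
    {M δ : ℝ} (hδ : 0 < δ) (hM : ∀ x : ℝ, 0 < x → ‖rieszMean lam m a x c‖ ≤ M) :
    ∃ C : ℝ, 0 ≤ C ∧ ∀ y : ℝ, 1 ≤ y → ∀ z : ℂ, z.re = δ →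
      ‖rieszMean lam m a y (c + z)‖ ≤ C * (1 + ‖z‖) ^ (m + 1) := by
  have hM0 : 0 ≤ M := (norm_nonneg _).trans (hM 1 one_pos)
  -- Half of the decay `exp (-δt)` is spent on `t ^ m / m!`, at the price of `(2 / δ) ^ m`.
  set K : ℝ := M * (2 / δ) ^ m with hK
  have hK0 : 0 ≤ K := by positivity
  refine ⟨m.factorial * (2 ^ m * (K * (1 + (δ / 2)⁻¹))), by positivity, fun y hy z hz => ?_⟩
  have hy0 : 0 < y := by linarith
  have hz0 : z ≠ 0 := by
    rintro rfl
    simp at hz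
    exact hδ.ne hz
  set S : C(ℝ, ℂ) := ∑ n ∈ lam.below y,
    (a n * Complex.exp (-(lam n : ℂ) * c)) • truncPow m (lam n) with hS
  have hSt : ∀ t, 0 < t → t ≤ y → S t = (t : ℂ) ^ m / m.factorial * rieszMean lam m a t c := by
    intro t ht hty
    rw [div_mul_eq_mul_div, pow_mul_rieszMean lam hm a c ht hty, hS, ContinuousMap.sum_apply,
      Finset.sum_div]
    refine Finset.sum_congr rfl fun n _ => ?_
    simp only [ContinuousMap.smul_apply, smul_eq_mul, truncPow_apply]
    push_cast
    ring
  have hS0 : S 0 = 0 := by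
    rw [hS, ContinuousMap.sum_apply]
    refine Finset.sum_eq_zero fun n _ => ?_
    rw [ContinuousMap.smul_apply, truncPow_of_le hm (lam.nonneg n), smul_zero]
  have hg : ∀ t, 0 ≤ t → t ≤ y → ‖twist z S t‖ ≤ K * Real.exp (-(δ / 2) * t) := by
    intro t ht hty
    rcases ht.eq_or_lt with rfl | ht
    · rw [twist_apply, hS0, mul_zero, norm_zero]
      positivity
    have h1 : (δ / 2 * t) ^ m / m.factorial ≤ Real.exp (δ / 2 * t) :=
      Real.pow_div_factorial_le_exp _ (by positivity) m
    have h2 : t ^ m / m.factorial ≤ (2 / δ) ^ m * Real.exp (δ / 2 * t) := by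
      have : t ^ m / m.factorial = (2 / δ) ^ m * ((δ / 2 * t) ^ m / m.factorial) := by
        rw [← mul_div_assoc, ← mul_pow]
        congr 2
        field_simp
      rw [this]
      gcongr
    have h3 : Real.exp (-(δ / 2) * t) = Real.exp (-δ * t) * Real.exp (δ / 2 * t) := by
      rw [← Real.exp_add]
      congr 1
      ring
    rw [twist_apply, hSt t ht hty, norm_mul, norm_mul, norm_div, norm_pow, Complex.norm_real,
      Real.norm_of_nonneg ht.le, Complex.norm_natCast, Complex.norm_exp, h3]
    have h4 : (-z * (t : ℂ)).re = -δ * t := by simp [hz]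
    rw [h4]
    calc Real.exp (-δ * t) * (t ^ m / m.factorial * ‖rieszMean lam m a t c‖)
        ≤ Real.exp (-δ * t) * ((2 / δ) ^ m * Real.exp (δ / 2 * t) * M) := by
          gcongr
          exact hM t ht
      _ = K * (Real.exp (-δ * t) * Real.exp (δ / 2 * t)) := by
          rw [hK]
          ring
  -- The operator transports the means at `c` to the means at `c + z`, so bounds on `[0, y]` for the
  -- former control the latter at `y`.
  have hJ : (resolventMap z ^ (m + 1)) (twist z S) y
      = (y : ℂ) ^ m / m.factorial * rieszMean lam m a y (c + z) := by
    rw [div_mul_eq_mul_div, pow_mul_rieszMean lam hm a (c + z) hy0 le_rfl, hS, map_sum, map_sum,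
      ContinuousMap.sum_apply, Finset.sum_div]
    refine Finset.sum_congr rfl fun n _ => ?_
    rw [map_smul, map_smul, resolventMap_pow_twist_truncPow hz0 (lam.nonneg n) hm]
    simp only [ContinuousMap.smul_apply, smul_eq_mul, truncPow_apply]
    rw [mul_add, Complex.exp_add, mul_comm (-z)]
    push_cast
    ring_nf
  have hb := norm_resolventMap_pow_le z hK0 (half_pos hδ) hg m y hy0.le le_rfl
  rw [hJ, norm_mul, norm_div, norm_pow, Complex.norm_real, Real.norm_of_nonneg hy0.le,
    Complex.norm_natCast] at hb
  -- Here `y ≥ 1` is needed: the polynomial factor is comparable to `y ^ m` and cancels.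
  have h2 : (1 + y) ^ m ≤ 2 ^ m * y ^ m := by
    rw [← mul_pow]
    gcongr
    linarith
  have hfp : (0 : ℝ) < m.factorial := by positivity
  rw [div_mul_eq_mul_div, div_le_iff₀ hfp] at hb
  have h3 : y ^ m * ‖rieszMean lam m a y (c + z)‖
      ≤ y ^ m * (m.factorial * (2 ^ m * (K * (1 + (δ / 2)⁻¹))) * (1 + ‖z‖) ^ (m + 1)) := by
    refine hb.trans ?_
    calc K * (1 + (δ / 2)⁻¹) * (1 + ‖z‖) ^ (m + 1) * (1 + y) ^ m * m.factorial
        ≤ K * (1 + (δ / 2)⁻¹) * (1 + ‖z‖) ^ (m + 1) * (2 ^ m * y ^ m) * m.factorial := by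
          gcongr
      _ = _ := by ring
  exact le_of_mul_le_mul_left h3 (by positivity)

/-! Perron's formula for Riesz means. -/

theorem hasDerivAt_truncPow {m : ℕ} (hm : 1 ≤ m) {lam : ℝ} (hl : 0 ≤ lam) (t : ℝ) :
    HasDerivAt (truncPow (m + 1) lam) (truncPow m lam t) t := by
  rw [← primitiveMap_truncPow hm hl]
  exact ((truncPow m lam).continuous.integral_hasStrictDerivAt 0 t).hasDerivAt

theorem sum_truncPow_eq_of_le (lam : Frequency) {k : ℕ} (hk : 1 ≤ k) (c : ℕ → ℂ) {x Y y : ℝ}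
    (hx : x ≤ Y) (hy : Y ≤ y) :
    ∑ n ∈ lam.below y, c n * truncPow k (lam n) x
      = ∑ n ∈ lam.below Y, c n * truncPow k (lam n) x := by
  symm
  refine Finset.sum_subset (fun n hn => ?_) fun n _ hn => ?_
  · rw [Frequency.mem_below] at hn ⊢
    linarith
  · rw [Frequency.mem_below, not_lt] at hn
    rw [truncPow_of_le hk (by linarith), mul_zero]

/-- Perron's formula for Dirichlet polynomials. -/
theorem integral_dirichletPolynomial_mul (lam : Frequency) (S : Finset ℕ) (c : ℕ → ℂ) (s : ℂ)
    (x : ℝ) {κ : ℝ} (hκ : 0 < κ) {k : ℕ} (hk : 1 ≤ k) :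
    ∫ τ : ℝ, (∑ n ∈ S, c n * Complex.exp (-(lam n : ℂ) * (s + ((κ : ℂ) + τ * Complex.I))))
        * (Complex.exp (x * ((κ : ℂ) + τ * Complex.I)) / ((κ : ℂ) + τ * Complex.I) ^ (k + 1))
      = 2 * Real.pi * ∑ n ∈ S, c n * Complex.exp (-(lam n : ℂ) * s) * truncPow k (lam n) x := by
  obtain ⟨j, rfl⟩ : ∃ j, k = j + 1 := ⟨k - 1, by omega⟩
  have hpt : ∀ τ : ℝ,
      (∑ n ∈ S, c n * Complex.exp (-(lam n : ℂ) * (s + ((κ : ℂ) + τ * Complex.I))))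
        * (Complex.exp (x * ((κ : ℂ) + τ * Complex.I)) / ((κ : ℂ) + τ * Complex.I) ^ (j + 1 + 1))
      = ∑ n ∈ S, c n * Complex.exp (-(lam n : ℂ) * s)
        * (Complex.exp ((x - lam n : ℝ) * ((κ : ℂ) + τ * Complex.I))
          / ((κ : ℂ) + τ * Complex.I) ^ (j + 1 + 1)) := by
    intro τ
    rw [Finset.sum_mul]
    refine Finset.sum_congr rfl fun n _ => ?_
    have h : Complex.exp (-(lam n : ℂ) * (s + ((κ : ℂ) + τ * Complex.I)))
        * Complex.exp (x * ((κ : ℂ) + τ * Complex.I))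
        = Complex.exp (-(lam n : ℂ) * s)
          * Complex.exp ((x - lam n : ℝ) * ((κ : ℂ) + τ * Complex.I)) := by
      rw [← Complex.exp_add, ← Complex.exp_add]
      congr 1
      push_cast
      ring
    linear_combination (c n / ((κ : ℂ) + τ * Complex.I) ^ (j + 1 + 1)) * h
  rw [integral_congr_ae (Eventually.of_forall hpt), integral_finsetSum _ fun n _ =>
    (integrable_cexp_div_pow _ hκ j).const_mul _, Finset.mul_sum]
  refine Finset.sum_congr rfl fun n _ => ?_
  rw [integral_const_mul, integral_cexp_div_pow _ hκ (by omega), truncPow_apply]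
  ring

/-- Perron's formula of high order, on a line in the half-plane of summability. -/
theorem integral_germ_mul_of_large (lam : Frequency) {m : ℕ} (hm : 1 ≤ m) {a : ℕ → ℂ} {F : ℂ → ℂ}
    {σ : ℝ} (ha : ∀ s : ℂ, σ < s.re →
      Tendsto (fun x : ℝ => rieszMean lam m a x s) atTop (𝓝 (F s)))
    (s : ℂ) {κ : ℝ} (hκ : 0 < κ) (hsκ : σ < s.re + κ) (j : ℕ) {x Y : ℝ} (hxY : x ≤ Y) :
    ∫ τ : ℝ, F (s + ((κ : ℂ) + τ * Complex.I)) * (Complex.exp (x * ((κ : ℂ) + τ * Complex.I))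
        / ((κ : ℂ) + τ * Complex.I) ^ (m + 2 + j + 1))
      = 2 * Real.pi * ∑ n ∈ lam.below Y, a n * Complex.exp (-(lam n : ℂ) * s)
        * truncPow (m + 2 + j) (lam n) x := by
  -- The point `c` below has real part midway between `σ` and the line of integration: the means
  -- converge at `c`, and the line lies at distance `δ` to its right.
  set δ : ℝ := (s.re + κ - σ) / 2 with hδ
  have hδ0 : 0 < δ := by
    rw [hδ]
    linarith
  set c : ℂ := s + κ - δ with hc
  have hcre : σ < c.re := by
    simp [hc, hδ]
    linarith
  obtain ⟨M, hM⟩ := rieszMean_bounded lam (Nat.cast_nonneg m) a c _ (ha c hcre)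
  obtain ⟨C, hC0, hC⟩ := exists_norm_rieszMean_le lam hm a c hδ0 hM
  set D : ℝ := (1 + δ) / κ + 1 with hD
  have hbound : ∀ y : ℝ, 1 ≤ y → ∀ τ : ℝ,
      ‖rieszMean lam m a y (s + ((κ : ℂ) + τ * Complex.I))‖
        ≤ C * D ^ (m + 1) * ‖(κ : ℂ) + τ * Complex.I‖ ^ (m + 1) := by
    intro y hy τ
    have e : s + ((κ : ℂ) + τ * Complex.I) = c + ((δ : ℂ) + τ * Complex.I) := by
      rw [hc]
      ring
    rw [e, mul_assoc, ← mul_pow]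
    refine (hC y hy _ (re_vertical δ τ)).trans ?_
    have h1 : ‖(δ : ℂ) + τ * Complex.I‖ ≤ δ + |τ| := by
      refine (norm_add_le _ _).trans_eq ?_
      simp [abs_of_pos hδ0]
    have h2 : |τ| ≤ ‖(κ : ℂ) + τ * Complex.I‖ := by
      simpa using Complex.abs_im_le_norm ((κ : ℂ) + τ * Complex.I)
    have h3 := le_norm_vertical κ τ
    have h4 : 1 + δ ≤ (1 + δ) / κ * ‖(κ : ℂ) + τ * Complex.I‖ := by
      rw [div_mul_eq_mul_div, le_div_iff₀ hκ]
      gcongr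
    gcongr
    rw [hD, add_mul, one_mul]
    linarith
  have hlim : Tendsto (fun y : ℝ => ∫ τ : ℝ, rieszMean lam m a y (s + ((κ : ℂ) + τ * Complex.I))
      * (Complex.exp (x * ((κ : ℂ) + τ * Complex.I))
        / ((κ : ℂ) + τ * Complex.I) ^ (m + 2 + j + 1))) atTop
      (𝓝 (∫ τ : ℝ, F (s + ((κ : ℂ) + τ * Complex.I))
        * (Complex.exp (x * ((κ : ℂ) + τ * Complex.I))
          / ((κ : ℂ) + τ * Complex.I) ^ (m + 2 + j + 1)))) := by
    -- The means grow with exponent `m + 1` and the kernel decays with exponent `m + 3 + j`, which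
    -- leaves an integrable `j + 2`.
    refine tendsto_integral_filter_of_dominated_convergence
      (fun τ => C * D ^ (m + 1) * Real.exp (x * κ) * ((κ ^ j)⁻¹ * (1 + (κ ^ 2)⁻¹))
        * (1 + τ ^ 2)⁻¹) (Eventually.of_forall fun y => ?_) ?_
      (integrable_inv_one_add_sq.const_mul _) ?_
    · refine (Continuous.mul ?_ (continuous_cexp_div_pow x hκ _)).aestronglyMeasurable
      unfold rieszMean
      fun_prop
    · filter_upwards [eventually_ge_atTop (1 : ℝ)] with y hy
      refine Eventually.of_forall fun τ => ?_
      have hw0 : 0 < ‖(κ : ℂ) + τ * Complex.I‖ := hκ.trans_le (le_norm_vertical κ τ)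
      have h5 := inv_norm_pow_le hκ (re_vertical κ τ).ge j
      rw [im_vertical] at h5
      rw [norm_mul, norm_div, norm_cexp_vertical, norm_pow]
      calc ‖rieszMean lam m a y (s + ((κ : ℂ) + τ * Complex.I))‖
            * (Real.exp (x * κ) / ‖(κ : ℂ) + τ * Complex.I‖ ^ (m + 2 + j + 1))
          ≤ C * D ^ (m + 1) * ‖(κ : ℂ) + τ * Complex.I‖ ^ (m + 1)
            * (Real.exp (x * κ) / ‖(κ : ℂ) + τ * Complex.I‖ ^ (m + 2 + j + 1)) := by
            gcongr
            exact hbound y hy τ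
        _ = C * D ^ (m + 1) * Real.exp (x * κ) * (‖(κ : ℂ) + τ * Complex.I‖ ^ (j + 2))⁻¹ := by
            rw [show m + 2 + j + 1 = (m + 1) + (j + 2) by ring, pow_add _ (m + 1)]
            field_simp
        _ ≤ C * D ^ (m + 1) * Real.exp (x * κ)
            * ((κ ^ j)⁻¹ * (1 + (κ ^ 2)⁻¹) * (1 + τ ^ 2)⁻¹) := by
            have : 0 ≤ D := by positivity
            gcongr
        _ = _ := by ring
    · refine Eventually.of_forall fun τ => ?_
      exact (ha _ (by simpa using hsκ)).mul_const _
  -- Since `x ≤ Y`, only the terms below `Y` survive in Perron's formula for the mean, and their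
  -- factors `(1 - lam n / y) ^ m` tend to one.
  have hsum : Tendsto (fun y : ℝ => 2 * (Real.pi : ℂ) * ∑ n ∈ lam.below Y,
      (a n * (((1 - lam n / y) ^ m : ℝ) : ℂ)) * Complex.exp (-(lam n : ℂ) * s)
        * truncPow (m + 2 + j) (lam n) x) atTop
      (𝓝 (2 * Real.pi * ∑ n ∈ lam.below Y, a n * Complex.exp (-(lam n : ℂ) * s)
        * truncPow (m + 2 + j) (lam n) x)) := by
    refine (tendsto_finsetSum _ fun n _ => ?_).const_mul _
    have h1 : Tendsto (fun y : ℝ => (1 - lam n / y) ^ m) atTop (𝓝 1) := by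
      have : Tendsto (fun y : ℝ => lam n / y) atTop (𝓝 0) := tendsto_const_nhds.div_atTop tendsto_id
      simpa using (this.const_sub 1).pow m
    have h2 : Tendsto (fun y : ℝ => (((1 - lam n / y) ^ m : ℝ) : ℂ)) atTop (𝓝 1) := by
      exact_mod_cast (Complex.continuous_ofReal.tendsto 1).comp h1
    simpa using ((h2.const_mul (a n)).mul_const (Complex.exp (-(lam n : ℂ) * s))).mul_const
      (truncPow (m + 2 + j) (lam n) x)
  refine tendsto_nhds_unique hlim (hsum.congr' ?_)
  filter_upwards [eventually_ge_atTop Y] with y hy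
  rw [← sum_truncPow_eq_of_le lam (by omega)
    (fun n => (a n * (((1 - lam n / y) ^ m : ℝ) : ℂ)) * Complex.exp (-(lam n : ℂ) * s)) hxY hy,
    ← integral_dirichletPolynomial_mul lam _ _ s x hκ (by omega)]
  refine integral_congr_ae (Eventually.of_forall fun τ => ?_)
  simp only [rieszMean, Real.rpow_natCast]
  congr 1
  refine Finset.sum_congr rfl fun n _ => ?_
  ring

/-! Functions of polynomial growth on vertical lines. -/

/-- Since `‖w‖ ≥ κ`, all constants can be absorbed into a multiple of `‖w‖`. -/
theorem norm_add_le_of_growth {F : ℂ → ℂ} {B : ℝ} {p : ℕ} (hB0 : 0 ≤ B)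
    (hB : ∀ s : ℂ, 0 < s.re → ‖F s‖ ≤ B * (1 + ‖s‖) ^ p) {s w : ℂ} (hs : 0 < s.re) {κ : ℝ}
    (hκ : 0 < κ) (hw : κ ≤ w.re) :
    ‖F (s + w)‖ ≤ B * ((1 + ‖s‖) * (1 + κ⁻¹)) ^ p * ‖w‖ ^ p := by
  have hn : κ ≤ ‖w‖ := hw.trans (Complex.re_le_norm w)
  refine (hB _ (by rw [Complex.add_re]; linarith)).trans ?_
  rw [mul_assoc, ← mul_pow]
  have h1 : 1 ≤ κ⁻¹ * ‖w‖ := by rwa [inv_mul_eq_div, one_le_div hκ]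
  have h2 := norm_add_le s w
  have h3 : 0 ≤ ‖s‖ * (κ⁻¹ * ‖w‖) := by positivity
  gcongr
  nlinarith [norm_nonneg s, norm_nonneg w]

theorem norm_mul_cexp_div_pow_le {F : ℂ → ℂ} {B : ℝ} {p : ℕ} (hB0 : 0 ≤ B)
    (hB : ∀ s : ℂ, 0 < s.re → ‖F s‖ ≤ B * (1 + ‖s‖) ^ p) {s w : ℂ} (hs : 0 < s.re) {κ : ℝ}
    (hκ : 0 < κ) (hw : κ ≤ w.re) (x : ℝ) (n : ℕ) :
    ‖F (s + w) * (Complex.exp (x * w) / w ^ (p + n + 2))‖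
      ≤ B * ((1 + ‖s‖) * (1 + κ⁻¹)) ^ p * ((κ ^ n)⁻¹ * (1 + (κ ^ 2)⁻¹)) * Real.exp (x * w.re)
        * (1 + w.im ^ 2)⁻¹ := by
  have hw0 : 0 < ‖w‖ := hκ.trans_le (hw.trans (Complex.re_le_norm w))
  have he : ‖Complex.exp (x * w)‖ = Real.exp (x * w.re) := by
    rw [Complex.norm_exp]
    simp
  rw [norm_mul, norm_div, he, norm_pow]
  calc ‖F (s + w)‖ * (Real.exp (x * w.re) / ‖w‖ ^ (p + n + 2))
      ≤ B * ((1 + ‖s‖) * (1 + κ⁻¹)) ^ p * ‖w‖ ^ p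
        * (Real.exp (x * w.re) / ‖w‖ ^ (p + n + 2)) := by
        gcongr
        exact norm_add_le_of_growth hB0 hB hs hκ hw
    _ = B * ((1 + ‖s‖) * (1 + κ⁻¹)) ^ p * Real.exp (x * w.re) * (‖w‖ ^ (n + 2))⁻¹ := by
        rw [add_assoc, pow_add]
        field_simp
    _ ≤ B * ((1 + ‖s‖) * (1 + κ⁻¹)) ^ p * Real.exp (x * w.re)
        * ((κ ^ n)⁻¹ * (1 + (κ ^ 2)⁻¹) * (1 + w.im ^ 2)⁻¹) := by
        gcongr
        exact inv_norm_pow_le hκ hw n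
    _ = _ := by ring

theorem continuous_vertical {F : ℂ → ℂ} (hF : DifferentiableOn ℂ F {s : ℂ | 0 < s.re}) {s : ℂ}
    (hs : 0 < s.re) {κ : ℝ} (hκ : 0 < κ) :
    Continuous fun τ : ℝ => F (s + ((κ : ℂ) + τ * Complex.I)) :=
  hF.continuousOn.comp_continuous (by fun_prop) fun τ => by
    simp
    linarith

/-- Each derivative in `x` brings down one factor `w`, hence lowers the order of the kernel by one.
This is legitimate while the resulting exponent is at least `p + 2`, whatever the order of
summability of the germ. -/
theorem hasDerivAt_integral_mul_cexp {F : ℂ → ℂ} {B : ℝ} {p : ℕ}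
    (hF : DifferentiableOn ℂ F {s : ℂ | 0 < s.re}) (hB0 : 0 ≤ B)
    (hB : ∀ s : ℂ, 0 < s.re → ‖F s‖ ≤ B * (1 + ‖s‖) ^ p) {s : ℂ} (hs : 0 < s.re) {κ : ℝ}
    (hκ : 0 < κ) (n : ℕ) (x : ℝ) :
    HasDerivAt (fun x : ℝ => ∫ τ : ℝ, F (s + ((κ : ℂ) + τ * Complex.I))
        * (Complex.exp (x * ((κ : ℂ) + τ * Complex.I)) / ((κ : ℂ) + τ * Complex.I) ^ (p + n + 3)))
      (∫ τ : ℝ, F (s + ((κ : ℂ) + τ * Complex.I))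
        * (Complex.exp (x * ((κ : ℂ) + τ * Complex.I)) / ((κ : ℂ) + τ * Complex.I) ^ (p + n + 2)))
      x := by
  have hcont : ∀ (y : ℝ) (k : ℕ), Continuous fun τ : ℝ => F (s + ((κ : ℂ) + τ * Complex.I))
      * (Complex.exp (y * ((κ : ℂ) + τ * Complex.I)) / ((κ : ℂ) + τ * Complex.I) ^ k) :=
    fun y k => (continuous_vertical hF hs hκ).mul (continuous_cexp_div_pow y hκ k)
  refine (hasDerivAt_integral_of_dominated_loc_of_deriv_le (Metric.ball_mem_nhds x one_pos)
    (F' := fun (y : ℝ) (τ : ℝ) => F (s + ((κ : ℂ) + τ * Complex.I))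
      * (Complex.exp (y * ((κ : ℂ) + τ * Complex.I)) / ((κ : ℂ) + τ * Complex.I) ^ (p + n + 2)))
    (bound := fun τ => B * ((1 + ‖s‖) * (1 + κ⁻¹)) ^ p * ((κ ^ n)⁻¹ * (1 + (κ ^ 2)⁻¹))
      * Real.exp ((x + 1) * κ) * (1 + τ ^ 2)⁻¹)
    (Eventually.of_forall fun y => (hcont y _).aestronglyMeasurable) ?_
    (hcont x _).aestronglyMeasurable (Eventually.of_forall fun τ y hy => ?_)
    (integrable_inv_one_add_sq.const_mul _) (Eventually.of_forall fun τ y _ => ?_)).2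
  · refine Integrable.mono' (integrable_inv_one_add_sq.const_mul
      (B * ((1 + ‖s‖) * (1 + κ⁻¹)) ^ p * ((κ ^ (n + 1))⁻¹ * (1 + (κ ^ 2)⁻¹))
        * Real.exp (x * κ))) (hcont x _).aestronglyMeasurable (Eventually.of_forall fun τ => ?_)
    have h := norm_mul_cexp_div_pow_le hB0 hB hs hκ (re_vertical κ τ).ge x (n + 1)
    rw [re_vertical, im_vertical] at h
    exact h
  · have h := norm_mul_cexp_div_pow_le hB0 hB hs hκ (re_vertical κ τ).ge y n
    rw [re_vertical, im_vertical] at h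
    refine h.trans ?_
    have hy' : y ≤ x + 1 := by
      have := (abs_lt.1 (by simpa [Real.dist_eq] using hy : |y - x| < 1)).2
      linarith
    gcongr
  · have hw := vertical_ne_zero hκ τ
    have h1 : HasDerivAt (fun y : ℝ => (y : ℂ) * ((κ : ℂ) + τ * Complex.I))
        (1 * ((κ : ℂ) + τ * Complex.I)) y :=
      (Complex.ofRealCLM.hasDerivAt (x := y)).mul_const _
    refine ((h1.cexp.div_const _).const_mul _).congr_deriv ?_
    rw [pow_succ _ (p + n + 2)]
    field_simp

/-- Perron's formula on a line in the half-plane of summability. -/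
theorem integral_germ_mul (lam : Frequency) {m : ℕ} (hm : 1 ≤ m) {a : ℕ → ℂ} {F : ℂ → ℂ}
    {σ : ℝ} (ha : ∀ s : ℂ, σ < s.re →
      Tendsto (fun x : ℝ => rieszMean lam m a x s) atTop (𝓝 (F s)))
    {B : ℝ} {p : ℕ} (hF : DifferentiableOn ℂ F {s : ℂ | 0 < s.re}) (hB0 : 0 ≤ B)
    (hB : ∀ s : ℂ, 0 < s.re → ‖F s‖ ≤ B * (1 + ‖s‖) ^ p)
    {s : ℂ} (hs : 0 < s.re) {κ : ℝ} (hκ : 0 < κ) (hsκ : σ < s.re + κ) (n : ℕ) {x Y : ℝ}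
    (hxY : x < Y) :
    ∫ τ : ℝ, F (s + ((κ : ℂ) + τ * Complex.I)) * (Complex.exp (x * ((κ : ℂ) + τ * Complex.I))
        / ((κ : ℂ) + τ * Complex.I) ^ (p + n + 2))
      = 2 * Real.pi * ∑ i ∈ lam.below Y, a i * Complex.exp (-(lam i : ℂ) * s)
        * truncPow (p + n + 1) (lam i) x := by
  -- The induction variable `i` bounds the number of derivatives separating the desired order from
  -- the high orders already treated. The strict inequality `x < Y` makes the formula one order
  -- higher valid in a neighbourhood of `x`, so it can be differentiated.
  have key : ∀ (i n : ℕ), m + 2 ≤ p + n + 1 + i → ∀ x < Y,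
      ∫ τ : ℝ, F (s + ((κ : ℂ) + τ * Complex.I)) * (Complex.exp (x * ((κ : ℂ) + τ * Complex.I))
        / ((κ : ℂ) + τ * Complex.I) ^ (p + n + 2))
      = 2 * Real.pi * ∑ i ∈ lam.below Y, a i * Complex.exp (-(lam i : ℂ) * s)
        * truncPow (p + n + 1) (lam i) x := by
    intro i
    induction i with
    | zero =>
      intro n hn x hx
      obtain ⟨j, hj⟩ : ∃ j, p + n + 1 = m + 2 + j := ⟨p + n + 1 - (m + 2), by omega⟩
      have := integral_germ_mul_of_large lam hm ha s hκ hsκ j hx.le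
      rwa [← hj] at this
    | succ i ih =>
      intro n hn x hx
      have h1 := hasDerivAt_integral_mul_cexp hF hB0 hB hs hκ n x
      have h2 : HasDerivAt (fun x : ℝ => 2 * (Real.pi : ℂ) * ∑ i ∈ lam.below Y,
          a i * Complex.exp (-(lam i : ℂ) * s) * truncPow (p + n + 1 + 1) (lam i) x)
          (2 * Real.pi * ∑ i ∈ lam.below Y, a i * Complex.exp (-(lam i : ℂ) * s)
            * truncPow (p + n + 1) (lam i) x) x :=
        (HasDerivAt.fun_sum fun i _ =>
          (hasDerivAt_truncPow (by omega) (lam.nonneg i) x).const_mul _).const_mul _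
      refine (h1.congr_of_eventuallyEq ?_).unique h2
      filter_upwards [Iio_mem_nhds hx] with y hy
      exact (ih (n + 1) (by omega) y hy).symm
  exact key (m + 2) n (by omega) x hxY

/-! The normalised form of Perron's formula. -/

/-- The weight `k! / (2π) * exp (1 + it) / (1 + it) ^ (k + 1)`. -/
noncomputable def perronWeight (k : ℕ) (t : ℝ) : ℂ :=
  k.factorial / (2 * Real.pi) * (Complex.exp (1 + t * Complex.I) / (1 + t * Complex.I) ^ (k + 1))

/-- The value of the Perron kernel at the point one is `1 / k!`, up to the factor `2π`. -/
theorem integral_perronWeight {k : ℕ} (hk : 1 ≤ k) : ∫ t : ℝ, perronWeight k t = 1 := by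
  have h := integral_cexp_div_pow 1 one_pos hk
  simp only [Complex.ofReal_one, one_mul] at h
  have hf : (k.factorial : ℂ) ≠ 0 := by exact_mod_cast k.factorial_ne_zero
  have hpc : (Real.pi : ℂ) ≠ 0 := by exact_mod_cast Real.pi_ne_zero
  simp only [perronWeight]
  rw [integral_const_mul, h]
  simp
  field_simp

theorem continuous_perronWeight (k : ℕ) : Continuous (perronWeight k) := by
  have h := (continuous_cexp_div_pow 1 one_pos (k + 1)).const_mul (k.factorial / (2 * Real.pi) : ℂ)
  simp only [Complex.ofReal_one, one_mul] at h
  exact h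

theorem integrable_pow_mul_perronWeight (j n : ℕ) :
    Integrable fun t : ℝ => ‖1 + t * Complex.I‖ ^ j * ‖perronWeight (j + n + 1) t‖ := by
  have hc := continuous_perronWeight (j + n + 1)
  refine Integrable.mono' ((integrable_cexp_div_pow 1 one_pos n).norm.const_mul
    ((j + n + 1).factorial / (2 * Real.pi)))
    (by fun_prop) (Eventually.of_forall fun t => ?_)
  have hw : 0 < ‖1 + t * Complex.I‖ := by
    have := le_norm_vertical 1 t
    simp only [Complex.ofReal_one] at this
    linarith
  rw [Real.norm_of_nonneg (by positivity), perronWeight, norm_mul, norm_div, norm_div, norm_mul,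
    Complex.norm_natCast]
  simp only [Complex.ofReal_one, one_mul, norm_div, norm_pow, Complex.norm_real,
    Real.norm_of_nonneg Real.pi_pos.le, Complex.norm_ofNat]
  refine le_of_eq ?_
  rw [show j + n + 1 + 1 = j + (n + 2) by ring, pow_add]
  field_simp

/-- Riesz means of a germ as averages of the function. -/
theorem rieszMean_eq_integral (lam : Frequency) {m : ℕ} (hm : 1 ≤ m) {a : ℕ → ℂ} {F : ℂ → ℂ}
    {σ : ℝ} (ha : ∀ s : ℂ, σ < s.re →
      Tendsto (fun x : ℝ => rieszMean lam m a x s) atTop (𝓝 (F s)))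
    {B : ℝ} {p : ℕ} (hF : DifferentiableOn ℂ F {s : ℂ | 0 < s.re}) (hB0 : 0 ≤ B)
    (hB : ∀ s : ℂ, 0 < s.re → ‖F s‖ ≤ B * (1 + ‖s‖) ^ p)
    {s : ℂ} (hs : 0 < s.re) (n : ℕ) {x : ℝ} (hx : 0 < x) :
    rieszMean lam ((p + n + 1 : ℕ) : ℝ) a x s
      = ∫ t : ℝ, F (s + (1 + t * Complex.I) / x) * perronWeight (p + n + 1) t := by
  have hx' : 0 < x⁻¹ := inv_pos.2 hx
  have hxc : (x : ℂ) ≠ 0 := by exact_mod_cast hx.ne'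
  set κ : ℝ := max x⁻¹ (σ + 1) with hκdef
  have hκ : x⁻¹ ≤ κ := le_max_left _ _
  have hκ0 : 0 < κ := hx'.trans_le hκ
  have hσ : σ < s.re + κ := by
    have := le_max_right x⁻¹ (σ + 1)
    rw [← hκdef] at this
    linarith
  have h1 := integral_germ_mul lam hm ha hF hB0 hB hs hκ0 hσ n (lt_add_one x)
  have h2 : ∫ τ : ℝ, F (s + (((x⁻¹ : ℝ) : ℂ) + τ * Complex.I))
        * (Complex.exp (x * (((x⁻¹ : ℝ) : ℂ) + τ * Complex.I))
          / (((x⁻¹ : ℝ) : ℂ) + τ * Complex.I) ^ (p + n + 2))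
      = ∫ τ : ℝ, F (s + ((κ : ℂ) + τ * Complex.I)) * (Complex.exp (x * ((κ : ℂ) + τ * Complex.I))
          / ((κ : ℂ) + τ * Complex.I) ^ (p + n + 2)) := by
    refine integral_vertical_eq
      (h := fun w => F (s + w) * (Complex.exp (x * w) / w ^ (p + n + 2)))
      (C := B * ((1 + ‖s‖) * (1 + x⁻¹⁻¹)) ^ p * ((x⁻¹ ^ n)⁻¹ * (1 + (x⁻¹ ^ 2)⁻¹))
        * Real.exp (x * κ)) hκ ?_ fun w hw hw' => ?_
    · refine DifferentiableOn.mul (hF.comp (by fun_prop) fun w hw => ?_)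
        (DifferentiableOn.div (by fun_prop) (by fun_prop) fun w hw => pow_ne_zero _ ?_)
      · have := hw.1
        simp
        linarith
      · rintro rfl
        have := hw.1
        simp at this
        linarith
    · refine (norm_mul_cexp_div_pow_le hB0 hB hs hx' hw x n).trans ?_
      gcongr
  -- The substitution `τ = t / x` turns the exponent `x * w` into `1 + it`, so the kernel no longer
  -- depends on `x`.
  have h3 : ∀ t : ℝ, F (s + (1 + t * Complex.I) / x) * perronWeight (p + n + 1) t
      = ((p + n + 1).factorial : ℂ) / (2 * Real.pi) / (x : ℂ) ^ (p + n + 2)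
        * (F (s + (((x⁻¹ : ℝ) : ℂ) + ((x⁻¹ * t : ℝ) : ℂ) * Complex.I))
          * (Complex.exp (x * (((x⁻¹ : ℝ) : ℂ) + ((x⁻¹ * t : ℝ) : ℂ) * Complex.I))
          / (((x⁻¹ : ℝ) : ℂ) + ((x⁻¹ * t : ℝ) : ℂ) * Complex.I) ^ (p + n + 2))) := by
    intro t
    have e : ((x⁻¹ : ℝ) : ℂ) + ((x⁻¹ * t : ℝ) : ℂ) * Complex.I = (1 + t * Complex.I) / x := by
      push_cast
      field_simp
    rw [e, perronWeight, mul_div_cancel₀ _ hxc, div_pow]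
    have hw : (1 : ℂ) + t * Complex.I ≠ 0 := by simpa using vertical_ne_zero one_pos t
    field_simp
  rw [integral_congr_ae (Eventually.of_forall h3), integral_const_mul,
    Measure.integral_comp_mul_left (fun τ : ℝ => F (s + (((x⁻¹ : ℝ) : ℂ) + τ * Complex.I))
        * (Complex.exp (x * (((x⁻¹ : ℝ) : ℂ) + τ * Complex.I))
          / (((x⁻¹ : ℝ) : ℂ) + τ * Complex.I) ^ (p + n + 2))), h2, h1, inv_inv, abs_of_pos hx,
    Complex.real_smul]
  have h4 := pow_mul_rieszMean lam (m := p + n + 1) (by omega) a s hx (lt_add_one x).le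
  have h5 : ∑ i ∈ lam.below (x + 1), a i * Complex.exp (-(lam i : ℂ) * s)
        * truncPow (p + n + 1) (lam i) x
      = (x : ℂ) ^ (p + n + 1) * rieszMean lam ((p + n + 1 : ℕ) : ℝ) a x s
        / (p + n + 1).factorial := by
    rw [h4, Finset.sum_div]
    refine Finset.sum_congr rfl fun i _ => ?_
    rw [truncPow_apply]
    push_cast
    ring
  rw [h5]
  have hf : ((p + n + 1).factorial : ℂ) ≠ 0 := by exact_mod_cast (p + n + 1).factorial_ne_zero
  have hpc : (Real.pi : ℂ) ≠ 0 := by exact_mod_cast Real.pi_ne_zero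
  field_simp
  ring

/-! Approximation of functions of finite order by Riesz means of a fixed order. -/

/-- An order for which the Riesz means of germs of functions in `H_{∞,l}` converge. -/
noncomputable def rieszOrder (l : ℝ≥0) : ℕ := ⌈l⌉₊ + 1 + 1

theorem le_rieszOrder (l : ℝ≥0) : (l : ℝ) ≤ rieszOrder l := by
  have h : l ≤ (⌈l⌉₊ : ℝ≥0) := Nat.le_ceil l
  have h' : (l : ℝ) ≤ (⌈l⌉₊ : ℝ) := by exact_mod_cast h
  rw [rieszOrder]
  push_cast
  linarith

theorem rpow_le_pow_ceil (l : ℝ≥0) {y : ℝ} (hy : 1 ≤ y) : y ^ (l : ℝ) ≤ y ^ ⌈l⌉₊ := by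
  rw [← Real.rpow_natCast]
  refine Real.rpow_le_rpow_of_exponent_le hy ?_
  exact_mod_cast Nat.le_ceil l

/-- Cauchy's estimate on discs of radius `u / 2`, which stay inside the half-plane, bounds the
derivative; the mean value inequality does the rest. -/
theorem norm_sub_le_of_growth {F : ℂ → ℂ} {B : ℝ} {l : ℝ≥0}
    (hF : DifferentiableOn ℂ F {s : ℂ | 0 < s.re}) (hB0 : 0 ≤ B)
    (hB : ∀ s : ℂ, 0 < s.re → ‖F s‖ ≤ B * (1 + ‖s‖) ^ (l : ℝ)) {u : ℝ} (hu : 0 < u) {s h : ℂ}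
    (hs : 0 < s.re) (hh : 0 ≤ h.re) :
    ‖F (s + u + h) - F (s + u)‖
      ≤ B * ((1 + 2 * u) * (1 + ‖s‖) * (1 + ‖h‖)) ^ (l : ℝ) / (u / 2) * ‖h‖ := by
  have hopen : IsOpen {s : ℂ | 0 < s.re} := isOpen_lt continuous_const Complex.continuous_re
  -- A convex set containing both points. The ball keeps the growth bound on it in terms of `‖s‖`,
  -- `u` and `‖h‖` alone.
  set S : Set ℂ := {z | u ≤ z.re} ∩ Metric.closedBall 0 (‖s‖ + u + ‖h‖) with hS
  have hconv : Convex ℝ S := (convex_halfSpace_re_ge u).inter (convex_closedBall _ _)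
  have hnorm : ‖s + (u : ℂ)‖ ≤ ‖s‖ + u := by
    refine (norm_add_le _ _).trans_eq ?_
    simp [abs_of_pos hu]
  have h1 : s + u ∈ S := by
    refine ⟨?_, ?_⟩
    · simp [hs.le]
    · rw [mem_closedBall_zero_iff]
      linarith [norm_nonneg h]
  have h2 : s + u + h ∈ S := by
    refine ⟨?_, ?_⟩
    · simp
      linarith
    · rw [mem_closedBall_zero_iff]
      linarith [norm_add_le (s + u) h]
  have hdiff : ∀ z ∈ S, DifferentiableAt ℂ F z := fun z hz =>
    (hF z (hu.trans_le hz.1)).differentiableAt (hopen.mem_nhds (hu.trans_le hz.1))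
  have hderiv : ∀ z ∈ S, ‖deriv F z‖
      ≤ B * ((1 + 2 * u) * (1 + ‖s‖) * (1 + ‖h‖)) ^ (l : ℝ) / (u / 2) := by
    intro z hz
    have hsub : ∀ w ∈ Metric.closedBall z (u / 2), 0 < w.re ∧ ‖w‖ ≤ ‖z‖ + u / 2 := by
      intro w hw
      rw [mem_closedBall_iff_norm] at hw
      have hr := (abs_le.1 ((Complex.abs_re_le_norm (w - z)).trans hw)).1
      rw [Complex.sub_re] at hr
      have hz1 : u ≤ z.re := hz.1
      refine ⟨by linarith, ?_⟩
      have := norm_add_le (w - z) z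
      rw [sub_add_cancel] at this
      linarith
    refine Complex.norm_deriv_le_of_forall_mem_sphere_norm_le (half_pos hu)
      (hF.diffContOnCl_ball fun w hw => (hsub w hw).1) fun w hw => ?_
    obtain ⟨hw1, hw2⟩ := hsub w (Metric.sphere_subset_closedBall hw)
    refine (hB w hw1).trans ?_
    have hz2 : ‖z‖ ≤ ‖s‖ + u + ‖h‖ := mem_closedBall_zero_iff.1 hz.2
    have h3 : 0 ≤ ‖s‖ * ‖h‖ := by positivity
    have h4 : 0 ≤ u * (‖s‖ + ‖h‖ + ‖s‖ * ‖h‖) := by positivity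
    gcongr
    nlinarith
  have := hconv.norm_image_sub_le_of_norm_deriv_le hdiff hderiv h1 h2
  rwa [add_sub_cancel_left] at this

/-! ### Comparison of a function with its Riesz means. -/

theorem one_le_norm_one_add_mul_I (t : ℝ) : 1 ≤ ‖(1 : ℂ) + t * Complex.I‖ := by
  simpa using le_norm_vertical 1 t

theorem RieszHSpace.norm_apply_le {lam : Frequency} {l : ℝ≥0} (f : RieszHSpace lam l)
    (s : RightHalfPlane) : ‖f.fn s‖ ≤ ‖f‖ * (1 + ‖(s : ℂ)‖) ^ (l : ℝ) :=
  (div_le_iff₀ (by positivity)).1 (HasGrowth.le f.2.2.1 s)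

theorem RieszHSpace.norm_le_of_forall {lam : Frequency} {l : ℝ≥0} {f : RieszHSpace lam l} {C : ℝ}
    (h : ∀ s : RightHalfPlane, ‖f.fn s‖ ≤ C * (1 + ‖(s : ℂ)‖) ^ (l : ℝ)) : ‖f‖ ≤ C :=
  growthNorm_le fun s => (div_le_iff₀ (by positivity)).2 (h s)

/-- Consistency of Riesz summation allows the order of the germ to be rounded up to a positive
integer, as Perron's formula requires. -/
theorem RieszHSpace.exists_extension {lam : Frequency} {l : ℝ≥0} (f : RieszHSpace lam l)
    {a : ℕ → ℂ} (ha : IsRieszGerm lam a f.fn) :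
    ∃ (F : ℂ → ℂ) (m : ℕ) (σ : ℝ), 1 ≤ m ∧ DifferentiableOn ℂ F {s : ℂ | 0 < s.re} ∧
      (∀ s : RightHalfPlane, F s = f.fn s) ∧
      (∀ s : ℂ, 0 < s.re → ‖F s‖ ≤ ‖f‖ * (1 + ‖s‖) ^ (l : ℝ)) ∧
      ∀ s : ℂ, σ < s.re → Tendsto (fun x : ℝ => rieszMean lam m a x s) atTop (𝓝 (F s)) := by
  obtain ⟨F, hF, hFf⟩ := f.2.1
  obtain ⟨m, hm, σ, hσ⟩ := ha
  refine ⟨F, ⌈m⌉₊ + 1, max σ 0, by omega, hF, hFf, fun s hs => ?_, fun s hs => ?_⟩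
  · rw [hFf ⟨s, hs⟩]
    exact f.norm_apply_le ⟨s, hs⟩
  · have hs0 : 0 < s.re := (le_max_right _ _).trans_lt hs
    rw [hFf ⟨s, hs0⟩]
    refine rieszMean_consistency lam hm ?_ a s _ (hσ ⟨s, hs0⟩ ((le_max_left _ _).trans_lt hs))
    push_cast
    linarith [Nat.le_ceil m]

/-- The mean is an average of values of the function at distance `‖1 + it‖ / x`, so the error is an
average of increments and gains `1 / x`. The weight `(1 + ‖s‖) ^ l` is that of the norm, and the
constant serves all functions and germs at once. -/
theorem exists_norm_rieszMean_sub_le (lam : Frequency) (l : ℝ≥0) {u : ℝ≥0} (hu : 0 < u) :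
    ∃ C : ℝ, 0 ≤ C ∧ ∀ (f : RieszHSpace lam l) (a : ℕ → ℂ), IsRieszGerm lam a f.fn →
      ∀ (s : RightHalfPlane) (x : ℝ), 1 ≤ x →
        ‖rieszMean lam (rieszOrder l) a x (shiftPoint u s) - f.fn (shiftPoint u s)‖
          ≤ C / x * ‖f‖ * (1 + ‖(s : ℂ)‖) ^ (l : ℝ) := by
  set p : ℕ := ⌈l⌉₊ with hp
  have hu' : (0 : ℝ) < u := hu
  have hW : Integrable fun t : ℝ =>
      ‖(1 : ℂ) + t * Complex.I‖ ^ (p + 1) * ‖perronWeight (p + 1 + 1) t‖ :=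
    integrable_pow_mul_perronWeight (p + 1) 0
  set W : ℝ := ∫ t : ℝ, ‖(1 : ℂ) + t * Complex.I‖ ^ (p + 1) * ‖perronWeight (p + 1 + 1) t‖ with hWd
  have hW0 : 0 ≤ W := integral_nonneg fun t => by positivity
  refine ⟨(1 + 2 * (u : ℝ)) ^ (l : ℝ) * 2 ^ p / (u / 2) * W, by positivity,
    fun f a ha s x hx => ?_⟩
  obtain ⟨F, m, σ, hm, hF, hFf, hB, hlim⟩ := f.exists_extension ha
  have hx0 : 0 < x := by linarith
  have hBp : ∀ s : ℂ, 0 < s.re → ‖F s‖ ≤ ‖f‖ * (1 + ‖s‖) ^ p := fun s hs =>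
    (hB s hs).trans (mul_le_mul_of_nonneg_left
      (rpow_le_pow_ceil l (by linarith [norm_nonneg s])) (norm_nonneg f))
  have hs' := (shiftPoint u s).2
  -- The choice `n = 1` gives the kernel one power more than the growth needs; it pays for the
  -- factor `‖1 + it‖` of the increment.
  have hR := rieszMean_eq_integral lam hm hlim hF (norm_nonneg f) hBp hs' 1 hx0
  set z : ℂ := ((shiftPoint u s : RightHalfPlane) : ℂ) with hz
  have hz' : z = s + ((u : ℝ) : ℂ) := rfl
  have hh : ∀ t : ℝ, ‖((1 : ℂ) + t * Complex.I) / x‖ = ‖(1 : ℂ) + t * Complex.I‖ / x := fun t => by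
    rw [norm_div, Complex.norm_real, Real.norm_of_nonneg hx0.le]
  have hre : ∀ t : ℝ, ((1 + t * Complex.I : ℂ) / x).re = x⁻¹ := fun t => by
    rw [Complex.div_ofReal_re]
    simp
  have hpt : ∀ t : ℝ, ‖(F (z + (1 + t * Complex.I) / x) - F z) * perronWeight (p + 1 + 1) t‖
      ≤ (1 + 2 * (u : ℝ)) ^ (l : ℝ) * 2 ^ p / (u / 2) / x * ‖f‖ * (1 + ‖(s : ℂ)‖) ^ (l : ℝ)
        * (‖(1 : ℂ) + t * Complex.I‖ ^ (p + 1) * ‖perronWeight (p + 1 + 1) t‖) := by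
    intro t
    have hv := one_le_norm_one_add_mul_I t
    have h1 := norm_sub_le_of_growth hF (norm_nonneg f) hB hu' s.2
      (h := (1 + t * Complex.I) / x) (by rw [hre]; positivity)
    rw [← hz', hh] at h1
    have h2 : ‖(1 : ℂ) + t * Complex.I‖ / x ≤ ‖(1 : ℂ) + t * Complex.I‖ :=
      div_le_self (by positivity) hx
    have h3 : (1 + ‖(1 : ℂ) + t * Complex.I‖ / x) ^ (l : ℝ)
        ≤ 2 ^ p * ‖(1 : ℂ) + t * Complex.I‖ ^ p := by
      rw [← mul_pow]
      have h0 := div_nonneg (norm_nonneg ((1 : ℂ) + t * Complex.I)) hx0.le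
      refine (rpow_le_pow_ceil l (by linarith)).trans ?_
      gcongr
      linarith
    rw [Real.mul_rpow (by positivity) (by positivity),
      Real.mul_rpow (by positivity) (by positivity)] at h1
    rw [norm_mul]
    calc ‖F (z + (1 + t * Complex.I) / x) - F z‖ * ‖perronWeight (p + 1 + 1) t‖
        ≤ ‖f‖ * ((1 + 2 * (u : ℝ)) ^ (l : ℝ) * (1 + ‖(s : ℂ)‖) ^ (l : ℝ)
            * (2 ^ p * ‖(1 : ℂ) + t * Complex.I‖ ^ p)) / (u / 2)
            * (‖(1 : ℂ) + t * Complex.I‖ / x) * ‖perronWeight (p + 1 + 1) t‖ := by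
          refine mul_le_mul_of_nonneg_right (h1.trans ?_) (norm_nonneg _)
          gcongr
      _ = _ := by
          rw [pow_succ]
          ring
  have hqi : Integrable (perronWeight (p + 1 + 1)) := by
    refine Integrable.mono' hW (continuous_perronWeight _).aestronglyMeasurable
      (Eventually.of_forall fun t => ?_)
    exact le_mul_of_one_le_left (norm_nonneg _) (one_le_pow₀ (one_le_norm_one_add_mul_I t))
  have hline : Continuous fun t : ℝ => F (z + (1 + t * Complex.I) / x) :=
    hF.continuousOn.comp_continuous (by fun_prop) fun t => by
      have := hre t
      rw [Set.mem_ofPred_eq, Complex.add_re, this]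
      positivity
  have hdi : Integrable fun t : ℝ =>
      (F (z + (1 + t * Complex.I) / x) - F z) * perronWeight (p + 1 + 1) t :=
    Integrable.mono' (hW.const_mul _) (((hline.sub continuous_const).mul
      (continuous_perronWeight _)).aestronglyMeasurable) (Eventually.of_forall hpt)
  have hsub : rieszMean lam (rieszOrder l) a x z - F z
      = ∫ t : ℝ, (F (z + (1 + t * Complex.I) / x) - F z) * perronWeight (p + 1 + 1) t := by
    have h4 : ∫ t : ℝ, F z * perronWeight (p + 1 + 1) t = F z := by
      rw [integral_const_mul, integral_perronWeight (by omega), mul_one]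
    have h5 : ∫ t : ℝ, F (z + (1 + t * Complex.I) / x) * perronWeight (p + 1 + 1) t
        = (∫ t : ℝ, (F (z + (1 + t * Complex.I) / x) - F z) * perronWeight (p + 1 + 1) t)
          + ∫ t : ℝ, F z * perronWeight (p + 1 + 1) t := by
      rw [← integral_add hdi (hqi.const_mul _)]
      congr 1
      ext t
      ring
    rw [rieszOrder, ← hp, hR, h5, h4]
    ring
  rw [← hFf, hsub]
  refine (norm_integral_le_of_norm_le (hW.const_mul _) (Eventually.of_forall hpt)).trans_eq ?_
  rw [integral_const_mul, ← hWd]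
  ring

theorem exists_norm_rieszMean_one_le (lam : Frequency) (l : ℝ≥0) {x : ℝ} (hx : 0 < x) :
    ∃ C : ℝ, 0 ≤ C ∧ ∀ (f : RieszHSpace lam l) (a : ℕ → ℂ), IsRieszGerm lam a f.fn →
      ‖rieszMean lam (rieszOrder l) a x 1‖ ≤ C * ‖f‖ := by
  set p : ℕ := ⌈l⌉₊ with hp
  have hW := integrable_pow_mul_perronWeight p 1
  set W : ℝ := ∫ t : ℝ, ‖(1 : ℂ) + t * Complex.I‖ ^ p * ‖perronWeight (p + 1 + 1) t‖ with hWd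
  have hW0 : 0 ≤ W := integral_nonneg fun t => by positivity
  have hx' : 0 < x⁻¹ := inv_pos.2 hx
  refine ⟨((1 + ‖(1 : ℂ)‖) * (1 + x⁻¹⁻¹)) ^ p / x ^ p * W, by positivity, fun f a ha => ?_⟩
  obtain ⟨F, m, σ, hm, hF, hFf, hB, hlim⟩ := f.exists_extension ha
  have hBp : ∀ s : ℂ, 0 < s.re → ‖F s‖ ≤ ‖f‖ * (1 + ‖s‖) ^ p := fun s hs =>
    (hB s hs).trans (mul_le_mul_of_nonneg_left
      (rpow_le_pow_ceil l (by linarith [norm_nonneg s])) (norm_nonneg f))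
  have h1 : 0 < (1 : ℂ).re := by simp
  rw [rieszOrder, ← hp, rieszMean_eq_integral lam hm hlim hF (norm_nonneg f) hBp h1 1 hx]
  refine (norm_integral_le_of_norm_le (hW.const_mul
    (‖f‖ * ((1 + ‖(1 : ℂ)‖) * (1 + x⁻¹⁻¹)) ^ p / x ^ p))
    (Eventually.of_forall fun t => ?_)).trans_eq ?_
  · have hre : ((1 + t * Complex.I : ℂ) / x).re = x⁻¹ := by
      rw [Complex.div_ofReal_re]
      simp
    have h2 := norm_add_le_of_growth (norm_nonneg f) hBp h1 hx' hre.ge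
    rw [norm_div, Complex.norm_real, Real.norm_of_nonneg hx.le, div_pow] at h2
    rw [norm_mul]
    refine (mul_le_mul_of_nonneg_right h2 (norm_nonneg _)).trans_eq ?_
    ring
  · rw [integral_const_mul, ← hWd]
    ring

/-! Coefficients of germs. -/

theorem Frequency.below_succ (lam : Frequency) (n : ℕ) :
    lam.below (lam (n + 1)) = Finset.range (n + 1) := by
  ext i
  rw [Frequency.mem_below, lam.strictMono.lt_iff_lt, Finset.mem_range]

/-- At `x = lam (n + 1)` the mean at the point `1` involves only the coefficients up to `n`, the
last one with nonzero weight, so the coefficients can be solved for recursively. Allowing an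
arbitrary germ makes uniqueness a corollary. -/
theorem exists_norm_coeff_le (lam : Frequency) (l : ℝ≥0) (n : ℕ) :
    ∃ C : ℝ, 0 ≤ C ∧ ∀ (f : RieszHSpace lam l) (a : ℕ → ℂ), IsRieszGerm lam a f.fn →
      ∀ i < n, ‖a i‖ ≤ C * ‖f‖ := by
  induction n with
  | zero => exact ⟨0, le_rfl, fun _ _ _ i hi => absurd hi (Nat.not_lt_zero i)⟩
  | succ n ih =>
    obtain ⟨C, hC0, hC⟩ := ih
    have hlt : lam n < lam (n + 1) := lam.strictMono (Nat.lt_succ_self n)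
    have hx : 0 < lam (n + 1) := (lam.nonneg n).trans_lt hlt
    obtain ⟨C', hC'0, hC'⟩ := exists_norm_rieszMean_one_le lam l hx
    set w : ℕ → ℂ := fun i => Complex.exp (-(lam i : ℂ) * 1)
      * (((1 - lam i / lam (n + 1)) ^ ((rieszOrder l : ℕ) : ℝ) : ℝ) : ℂ) with hw
    have hwn : 0 < ‖w n‖ := by
      rw [norm_pos_iff, hw]
      refine mul_ne_zero (Complex.exp_ne_zero _) ?_
      rw [Complex.ofReal_ne_zero]
      refine (Real.rpow_pos_of_pos ?_ _).ne'
      rw [sub_pos, div_lt_one hx]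
      exact hlt
    set V : ℝ := ∑ i ∈ Finset.range n, ‖w i‖ with hV
    have hV0 : 0 ≤ V := Finset.sum_nonneg fun _ _ => norm_nonneg _
    refine ⟨max C ((C' + C * V) / ‖w n‖), le_max_of_le_left hC0, fun f a ha i hi => ?_⟩
    rcases (Nat.lt_succ_iff.1 hi).lt_or_eq with h | rfl
    · exact (hC f a ha i h).trans (mul_le_mul_of_nonneg_right (le_max_left _ _) (norm_nonneg f))
    · refine le_trans ?_ (mul_le_mul_of_nonneg_right (le_max_right _ _) (norm_nonneg f))
      have h1 : rieszMean lam (rieszOrder l) a (lam (i + 1)) 1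
          = ∑ j ∈ Finset.range i, a j * w j + a i * w i := by
        rw [rieszMean, Frequency.below_succ, Finset.sum_range_succ]
        simp only [hw, mul_assoc]
      have h2 : ‖∑ j ∈ Finset.range i, a j * w j‖ ≤ C * ‖f‖ * V := by
        rw [hV, Finset.mul_sum]
        refine (norm_sum_le _ _).trans (Finset.sum_le_sum fun j hj => ?_)
        rw [norm_mul]
        exact mul_le_mul_of_nonneg_right (hC f a ha j (Finset.mem_range.1 hj)) (norm_nonneg _)
      have h3 := hC' f a ha
      rw [div_mul_eq_mul_div, le_div_iff₀ hwn, ← norm_mul]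
      have h4 : a i * w i = rieszMean lam (rieszOrder l) a (lam (i + 1)) 1
          - ∑ j ∈ Finset.range i, a j * w j := by
        rw [h1]
        ring
      rw [h4]
      refine (norm_sub_le _ _).trans ((add_le_add h3 h2).trans_eq ?_)
      ring

theorem IsRieszGerm.sub {lam : Frequency} {a b : ℕ → ℂ} {f g : RightHalfPlane → ℂ}
    (hf : IsRieszGerm lam a f) (hg : IsRieszGerm lam b g) :
    IsRieszGerm lam (a - b) (f - g) := by
  have h := hf.add (hg.smul (-1))
  rwa [neg_one_smul, neg_one_smul, ← sub_eq_add_neg, ← sub_eq_add_neg] at h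

/-- The difference of two germs is a germ of the zero function, whose coefficients are bounded by a
multiple of zero. -/
theorem RieszHSpace.germ_unique {lam : Frequency} {l : ℝ≥0} (f : RieszHSpace lam l) {a b : ℕ → ℂ}
    (ha : IsRieszGerm lam a f.fn) (hb : IsRieszGerm lam b f.fn) : a = b := by
  funext n
  obtain ⟨C, -, hC⟩ := exists_norm_coeff_le lam l (n + 1)
  have h := hC (f - f) (a - b) (ha.sub hb) n (Nat.lt_succ_self n)
  rw [sub_self, norm_zero, mul_zero, norm_le_zero_iff] at h
  exact sub_eq_zero.1 h

/-- The coefficients of the germ of a function. -/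
noncomputable def RieszHSpace.coeff {lam : Frequency} {l : ℝ≥0} (f : RieszHSpace lam l) : ℕ → ℂ :=
  Classical.choose f.2.2.2

theorem RieszHSpace.coeff_spec {lam : Frequency} {l : ℝ≥0} (f : RieszHSpace lam l) :
    IsRieszGerm lam f.coeff f.fn :=
  Classical.choose_spec f.2.2.2

theorem RieszHSpace.coeff_eq {lam : Frequency} {l : ℝ≥0} (f : RieszHSpace lam l) {a : ℕ → ℂ}
    (ha : IsRieszGerm lam a f.fn) : f.coeff = a :=
  f.germ_unique f.coeff_spec ha

theorem RieszHSpace.exists_norm_coeff_le (lam : Frequency) (l : ℝ≥0) (n : ℕ) :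
    ∃ C : ℝ, 0 ≤ C ∧ ∀ f : RieszHSpace lam l, ‖f.coeff n‖ ≤ C * ‖f‖ := by
  obtain ⟨C, hC0, hC⟩ := _root_.exists_norm_coeff_le lam l (n + 1)
  exact ⟨C, hC0, fun f => hC f _ f.coeff_spec n (Nat.lt_succ_self n)⟩

theorem RieszHSpace.coeff_sub {lam : Frequency} {l : ℝ≥0} (f g : RieszHSpace lam l) :
    (f - g).coeff = f.coeff - g.coeff :=
  coeff_eq _ (f.coeff_spec.sub g.coeff_spec)

theorem RieszHSpace.uniformContinuous_coeff (lam : Frequency) (l : ℝ≥0) (n : ℕ) :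
    UniformContinuous fun f : RieszHSpace lam l => f.coeff n := by
  obtain ⟨C, hC0, hC⟩ := RieszHSpace.exists_norm_coeff_le lam l n
  refine (LipschitzWith.of_dist_le_mul (K := ⟨C, hC0⟩) fun f g => ?_).uniformContinuous
  have h := hC (f - g)
  rw [coeff_sub] at h
  rw [dist_eq_norm, dist_eq_norm]
  exact h

/-! Translations and limits in `H_{∞,l}`. -/

/-- Half of the real part serves as the shift. This reduces pointwise statements to estimates on
translated half-planes. -/
theorem exists_shiftPoint_eq (t : RightHalfPlane) :
    ∃ (u : ℝ≥0) (s : RightHalfPlane), 0 < u ∧ shiftPoint u s = t := by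
  have h : 0 < (t : ℂ).re / 2 := half_pos t.2
  refine ⟨⟨(t : ℂ).re / 2, h.le⟩, ⟨t - ((t : ℂ).re / 2 : ℝ), ?_⟩, h, ?_⟩
  · rw [Complex.sub_re, Complex.ofReal_re]
    linarith
  · exact Subtype.ext (sub_add_cancel _ _)

/-- The translation `s ↦ f (s + u)`. -/
noncomputable def RieszHSpace.shift {lam : Frequency} {l : ℝ≥0} (u : ℝ≥0) (f : RieszHSpace lam l) :
    RieszHSpace lam l :=
  ⟨f.fn ∘ shiftPoint u, HSubmodule.translate_mem f.2 u⟩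

theorem RieszHSpace.tendsto_rieszMean {lam : Frequency} {l : ℝ≥0} (f : RieszHSpace lam l)
    {a : ℕ → ℂ} (ha : IsRieszGerm lam a f.fn) (t : RightHalfPlane) :
    Tendsto (fun x : ℝ => rieszMean lam (rieszOrder l) a x t) atTop (𝓝 (f.fn t)) := by
  obtain ⟨u, s, hu, rfl⟩ := exists_shiftPoint_eq t
  obtain ⟨C, -, hC⟩ := exists_norm_rieszMean_sub_le lam l hu
  rw [tendsto_iff_norm_sub_tendsto_zero]
  have h0 : Tendsto (fun x : ℝ => C / x * ‖f‖ * (1 + ‖(s : ℂ)‖) ^ (l : ℝ)) atTop (𝓝 0) := by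
    simpa using ((tendsto_const_nhds.div_atTop tendsto_id).mul_const ‖f‖).mul_const
      ((1 + ‖(s : ℂ)‖) ^ (l : ℝ))
  refine squeeze_zero' (Eventually.of_forall fun x => norm_nonneg _) ?_ h0
  filter_upwards [eventually_ge_atTop (1 : ℝ)] with x hx using hC f a ha s x hx

theorem norm_rieszMean_sub_le (lam : Frequency) (k : ℕ) (a b : ℕ → ℂ) {x : ℝ} (hx : 0 < x)
    (s : RightHalfPlane) :
    ‖rieszMean lam k a x s - rieszMean lam k b x s‖ ≤ ∑ n ∈ lam.below x, ‖a n - b n‖ := by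
  rw [rieszMean, rieszMean, ← Finset.sum_sub_distrib]
  refine (norm_sum_le _ _).trans (Finset.sum_le_sum fun n hn => ?_)
  rw [Frequency.mem_below] at hn
  have h0 : 0 ≤ 1 - lam n / x := by rw [sub_nonneg, div_le_one hx]; exact hn.le
  have h1 : 1 - lam n / x ≤ 1 := by linarith [div_nonneg (lam.nonneg n) hx.le]
  rw [← sub_mul, ← sub_mul, norm_mul, norm_mul, Complex.norm_real,
    Real.norm_of_nonneg (Real.rpow_nonneg h0 _), Complex.norm_exp, mul_assoc]
  refine mul_le_of_le_one_right (norm_nonneg _)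
    (mul_le_one₀ (Real.exp_le_one_iff.2 ?_) (Real.rpow_nonneg h0 _)
      (Real.rpow_le_one h0 h1 (Nat.cast_nonneg k)))
  have := mul_nonneg (lam.nonneg n) s.2.le
  simpa using this

theorem tendsto_rieszMean_coeff (lam : Frequency) (k x : ℝ) (s : ℂ) {b : ℕ → ℕ → ℂ} {a : ℕ → ℂ}
    (hb : ∀ n, Tendsto (fun N => b N n) atTop (𝓝 (a n))) :
    Tendsto (fun N => rieszMean lam k (b N) x s) atTop (𝓝 (rieszMean lam k a x s)) :=
  tendsto_finsetSum _ fun n _ => ((hb n).mul_const _).mul_const _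

/-- The error between `f N` and its means is uniform in `N`, while for fixed `x` the means are
finite sums that converge with the coefficients. The limit function is built as the limit of the
means of `a`, and the convergence on translates is an interchange of limits. -/
theorem exists_tendsto_of_tendsto_coeff {lam : Frequency} {l : ℝ≥0} {f : ℕ → RieszHSpace lam l}
    {B : ℝ} (hfB : ∀ N, ‖f N‖ ≤ B) {a : ℕ → ℂ}
    (ha : ∀ n, Tendsto (fun N => (f N).coeff n) atTop (𝓝 (a n))) :
    ∃ g : RieszHSpace lam l, IsRieszGerm lam a g.fn ∧
      (∀ s, Tendsto (fun N => (f N).fn s) atTop (𝓝 (g.fn s))) ∧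
      ∀ u : ℝ≥0, 0 < u → Tendsto (fun N => (f N).shift u) atTop (𝓝 (g.shift u)) := by
  have hB0 : 0 ≤ B := (norm_nonneg _).trans (hfB 0)
  choose! C hC0 hC using fun (u : ℝ≥0) (hu : 0 < u) => exists_norm_rieszMean_sub_le lam l hu
  have hC' : ∀ u : ℝ≥0, 0 < u → ∀ N (s : RightHalfPlane) (x : ℝ), 1 ≤ x →
      ‖rieszMean lam (rieszOrder l) (f N).coeff x (shiftPoint u s) - (f N).fn (shiftPoint u s)‖
        ≤ C u / x * B * (1 + ‖(s : ℂ)‖) ^ (l : ℝ) := fun u hu N s x hx => by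
    refine (hC u hu (f N) _ (f N).coeff_spec s x hx).trans ?_
    have := hC0 u hu
    gcongr
    exact hfB N
  -- Fixing `x` and `y` and letting `N → ∞` transfers the uniform error bound to the limiting
  -- coefficients, with no function attached to them yet.
  have hcauchy : ∀ u : ℝ≥0, 0 < u → ∀ (s : RightHalfPlane) (x y : ℝ), 1 ≤ x → x ≤ y →
      ‖rieszMean lam (rieszOrder l) a x (shiftPoint u s)
        - rieszMean lam (rieszOrder l) a y (shiftPoint u s)‖
        ≤ 2 * (C u / x * B * (1 + ‖(s : ℂ)‖) ^ (l : ℝ)) := by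
    intro u hu s x y hx hxy
    refine le_of_tendsto ((tendsto_rieszMean_coeff lam _ x _ ha).sub
      (tendsto_rieszMean_coeff lam _ y _ ha)).norm (Eventually.of_forall fun N => ?_)
    have h1 := hC' u hu N s x hx
    have h2 := hC' u hu N s y (hx.trans hxy)
    have h3 : C u / y * B * (1 + ‖(s : ℂ)‖) ^ (l : ℝ)
        ≤ C u / x * B * (1 + ‖(s : ℂ)‖) ^ (l : ℝ) := by
      have := hC0 u hu
      gcongr
    rw [← norm_neg, neg_sub] at h2
    refine (norm_sub_le_norm_sub_add_norm_sub _ ((f N).fn (shiftPoint u s)) _).trans ?_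
    linarith
  have hdecay : ∀ (u : ℝ≥0) (s : RightHalfPlane), Tendsto
      (fun x : ℝ => 2 * (C u / x * B * (1 + ‖(s : ℂ)‖) ^ (l : ℝ))) atTop (𝓝 0) := fun u s => by
    simpa using (((tendsto_const_nhds.div_atTop tendsto_id).mul_const B).mul_const
      ((1 + ‖(s : ℂ)‖) ^ (l : ℝ))).const_mul 2
  have hex : ∀ t : RightHalfPlane, ∃ L : ℂ,
      Tendsto (fun x : ℝ => rieszMean lam (rieszOrder l) a x t) atTop (𝓝 L) := by
    intro t
    obtain ⟨u, s, hu, rfl⟩ := exists_shiftPoint_eq t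
    -- The bounds hold only for `x ≥ 1`; the maximum extends them to a Cauchy net on all of `ℝ`.
    have hmax : Tendsto (fun x : ℝ => max x 1) atTop atTop :=
      tendsto_atTop_mono (fun x => le_max_left x 1) tendsto_id
    have h := cauchySeq_of_le_tendsto_0'
      (s := fun x : ℝ => rieszMean lam (rieszOrder l) a (max x 1) (shiftPoint u s))
      (fun x : ℝ => 2 * (C u / max x 1 * B * (1 + ‖(s : ℂ)‖) ^ (l : ℝ)))
      (fun x y hxy => by
        rw [dist_eq_norm]
        exact hcauchy u hu s _ _ (le_max_right _ _) (max_le_max_right 1 hxy))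
      ((hdecay u s).comp hmax)
    obtain ⟨L, hL⟩ := cauchySeq_tendsto_of_complete h
    refine ⟨L, hL.congr' ?_⟩
    filter_upwards [eventually_ge_atTop (1 : ℝ)] with x hx
    rw [max_eq_left hx]
  choose g hg using hex
  have hgR : ∀ u : ℝ≥0, 0 < u → ∀ (s : RightHalfPlane) (x : ℝ), 1 ≤ x →
      ‖rieszMean lam (rieszOrder l) a x (shiftPoint u s) - g (shiftPoint u s)‖
        ≤ 2 * (C u / x * B * (1 + ‖(s : ℂ)‖) ^ (l : ℝ)) := by
    intro u hu s x hx
    refine le_of_tendsto ((hg (shiftPoint u s)).const_sub _).norm ?_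
    filter_upwards [eventually_ge_atTop x] with y hy using hcauchy u hu s x y hx hy
  have hunif : ∀ u : ℝ≥0, 0 < u → ∀ ε : ℝ, 0 < ε → ∀ᶠ N in atTop, ∀ s : RightHalfPlane,
      ‖(f N).fn (shiftPoint u s) - g (shiftPoint u s)‖ ≤ ε * (1 + ‖(s : ℂ)‖) ^ (l : ℝ) := by
    intro u hu ε hε
    -- One error for `f N` against its mean and two for the mean of `a` against `g`.
    have h1 : Tendsto (fun x : ℝ => 3 * (C u / x * B)) atTop (𝓝 0) := by
      simpa using ((tendsto_const_nhds.div_atTop tendsto_id).mul_const B).const_mul (3 : ℝ)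
    obtain ⟨x, hx1, hx2⟩ := ((h1.eventually_le_const (half_pos hε)).and
      (eventually_ge_atTop (1 : ℝ))).exists
    have h2 : Tendsto (fun N => ∑ n ∈ lam.below x, ‖(f N).coeff n - a n‖) atTop (𝓝 0) := by
      have : Tendsto (fun N => ∑ n ∈ lam.below x, ‖(f N).coeff n - a n‖) atTop
          (𝓝 (∑ n ∈ lam.below x, 0)) :=
        tendsto_finsetSum _ fun n _ => tendsto_iff_norm_sub_tendsto_zero.1 (ha n)
      simpa using this
    filter_upwards [h2.eventually_le_const (half_pos hε)] with N hN s
    have hl1 : 1 ≤ (1 + ‖(s : ℂ)‖) ^ (l : ℝ) :=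
      Real.one_le_rpow (by linarith [norm_nonneg (s : ℂ)]) l.2
    have h3 := hC' u hu N s x hx2
    have h4 := hgR u hu s x hx2
    have h5 := norm_rieszMean_sub_le lam (rieszOrder l) (f N).coeff a
      (zero_lt_one.trans_le hx2) (shiftPoint u s)
    rw [← norm_neg, neg_sub] at h3
    have h6 := norm_sub_le_norm_sub_add_norm_sub ((f N).fn (shiftPoint u s))
      (rieszMean lam (rieszOrder l) (f N).coeff x (shiftPoint u s)) (g (shiftPoint u s))
    have h7 := norm_sub_le_norm_sub_add_norm_sub
      (rieszMean lam (rieszOrder l) (f N).coeff x (shiftPoint u s))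
      (rieszMean lam (rieszOrder l) a x (shiftPoint u s)) (g (shiftPoint u s))
    have h8 : 3 * (C u / x * B) * (1 + ‖(s : ℂ)‖) ^ (l : ℝ)
        ≤ ε / 2 * (1 + ‖(s : ℂ)‖) ^ (l : ℝ) := by gcongr
    have h9 : ε / 2 ≤ ε / 2 * (1 + ‖(s : ℂ)‖) ^ (l : ℝ) :=
      le_mul_of_one_le_right (half_pos hε).le hl1
    linarith
  have hpt : ∀ s, Tendsto (fun N => (f N).fn s) atTop (𝓝 (g s)) := by
    intro t
    obtain ⟨u, s, hu, rfl⟩ := exists_shiftPoint_eq t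
    have hpos : 0 < (1 + ‖(s : ℂ)‖) ^ (l : ℝ) := by positivity
    rw [Metric.tendsto_nhds]
    intro ε hε
    filter_upwards [hunif u hu (ε / 2 / (1 + ‖(s : ℂ)‖) ^ (l : ℝ)) (by positivity)] with N hN
    rw [dist_eq_norm]
    have := hN s
    rw [div_mul_cancel₀ _ hpos.ne'] at this
    linarith
  have hgrowth : HasGrowth l g := by
    refine HasGrowth.of_le (C := B) fun s => ?_
    rw [div_le_iff₀ (by positivity)]
    refine le_of_tendsto (hpt s).norm (Eventually.of_forall fun N => ?_)
    exact ((f N).norm_apply_le s).trans (mul_le_mul_of_nonneg_right (hfB N) (by positivity))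
  have hholo : IsHolomorphic g := by
    classical
    choose F hF hFf' using fun N => (f N).2.1
    have hFf : ∀ N (s : RightHalfPlane), F N s = (f N).fn s := hFf'
    set G : ℂ → ℂ := fun z => if h : 0 < z.re then g ⟨z, h⟩ else 0 with hG
    have hGg : ∀ s : RightHalfPlane, G s = g s := fun s => by
      have := s.2
      simp only [hG, dif_pos this]
    have hopen : IsOpen {s : ℂ | 0 < s.re} := isOpen_lt continuous_const Complex.continuous_re
    refine ⟨G, ?_, hGg⟩
    refine TendstoLocallyUniformlyOn.differentiableOn (φ := atTop) (F := F) ?_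
      (Eventually.of_forall hF) hopen
    rw [Metric.tendstoLocallyUniformlyOn_iff]
    intro ε hε z hz
    have hz' : 0 < z.re := hz
    -- Near `z` all points are translates by this `u` of points of bounded modulus, so weighted
    -- convergence on the translate is locally uniform.
    set u : ℝ≥0 := ⟨z.re / 2, (half_pos hz').le⟩ with hu
    have hu0 : 0 < u := half_pos hz'
    set R : ℝ := 1 + (‖z‖ + 1 + z.re / 2) with hR
    have hR0 : 0 < R := by positivity
    refine ⟨{w | z.re / 2 < w.re} ∩ Metric.ball z 1, mem_nhdsWithin_of_mem_nhds
      (inter_mem ((isOpen_lt continuous_const Complex.continuous_re).mem_nhds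
        (by rw [Set.mem_ofPred_eq]; linarith)) (Metric.ball_mem_nhds z one_pos)), ?_⟩
    filter_upwards [hunif u hu0 (ε / 2 / R ^ (l : ℝ)) (by positivity)] with N hN w hw
    have hw1 : z.re / 2 < w.re := hw.1
    have hw2 : ‖w‖ ≤ ‖z‖ + 1 := by
      have h1 : ‖w - z‖ < 1 := mem_ball_iff_norm.1 hw.2
      have h2 := norm_add_le (w - z) z
      rw [sub_add_cancel] at h2
      linarith
    set s : RightHalfPlane := ⟨w - (z.re / 2 : ℝ), by
      rw [Complex.sub_re, Complex.ofReal_re]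
      linarith⟩ with hs
    have hsw : shiftPoint u s = ⟨w, by linarith⟩ := Subtype.ext (sub_add_cancel _ _)
    have h1 := hN s
    have hsn : ‖(s : ℂ)‖ ≤ ‖z‖ + 1 + z.re / 2 := by
      have h2 := norm_sub_le w ((z.re / 2 : ℝ) : ℂ)
      rw [Complex.norm_real, Real.norm_of_nonneg (half_pos hz').le] at h2
      exact h2.trans (by linarith)
    rw [← hFf N, ← hGg, hsw] at h1
    rw [dist_eq_norm, norm_sub_rev]
    have h3 : ε / 2 / R ^ (l : ℝ) * (1 + ‖(s : ℂ)‖) ^ (l : ℝ) ≤ ε / 2 := by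
      have : (1 + ‖(s : ℂ)‖) ^ (l : ℝ) ≤ R ^ (l : ℝ) := by
        refine Real.rpow_le_rpow (by positivity) ?_ l.2
        rw [hR]
        linarith
      have hRl : 0 < R ^ (l : ℝ) := by positivity
      rw [div_mul_eq_mul_div, div_le_iff₀ hRl]
      gcongr
    exact (h1.trans h3).trans_lt (half_lt_self hε)
  have hgerm : IsRieszGerm lam a g :=
    ⟨rieszOrder l, Nat.cast_nonneg _, 0, fun s _ => hg s⟩
  refine ⟨⟨g, hholo, hgrowth, a, hgerm⟩, hgerm, hpt, fun u hu => ?_⟩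
  rw [tendsto_iff_norm_sub_tendsto_zero, Metric.tendsto_nhds]
  intro ε hε
  filter_upwards [hunif u hu (ε / 2) (half_pos hε)] with N hN
  rw [dist_zero_right, norm_norm]
  exact (RieszHSpace.norm_le_of_forall hN).trans_lt (half_lt_self hε)

/-! ### Completeness and Montel's theorem for the function space. -/

/-- Coefficients depend continuously on the function, so those of a Cauchy sequence converge and a
pointwise limit in the space exists. The Cauchy bounds then pass to this limit and give norm
convergence without translation. -/
instance RieszHSpace.completeSpace (lam : Frequency) (l : ℝ≥0) :
    CompleteSpace (RieszHSpace lam l) := by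
  refine Metric.complete_of_cauchySeq_tendsto fun f hf => ?_
  obtain ⟨B, hB⟩ := hf.norm_bddAbove
  have hc : ∀ n, ∃ c : ℂ, Tendsto (fun N => (f N).coeff n) atTop (𝓝 c) := fun n =>
    cauchySeq_tendsto_of_complete ((uniformContinuous_coeff lam l n).comp_cauchySeq hf)
  choose a ha using hc
  obtain ⟨g, -, hg, -⟩ := exists_tendsto_of_tendsto_coeff (fun N => hB ⟨N, rfl⟩) ha
  refine ⟨g, Metric.tendsto_atTop.2 fun ε hε => ?_⟩
  obtain ⟨N₀, hN₀⟩ := Metric.cauchySeq_iff.1 hf (ε / 2) (half_pos hε)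
  refine ⟨N₀, fun N hN => ?_⟩
  rw [dist_eq_norm]
  refine lt_of_le_of_lt (norm_le_of_forall fun s => ?_) (half_lt_self hε)
  refine le_of_tendsto ((hg s).const_sub ((f N).fn s)).norm ?_
  filter_upwards [eventually_ge_atTop N₀] with M hM
  have h := hN₀ N hN M hM
  rw [dist_eq_norm] at h
  exact ((f N - f M).norm_apply_le s).trans (mul_le_mul_of_nonneg_right h.le (by positivity))

/-- Montel's theorem for `H_{∞,l}`. -/
theorem RieszHSpace.exists_subseq_tendsto_shift {lam : Frequency} {l : ℝ≥0}
    {f : ℕ → RieszHSpace lam l} {B : ℝ} (hfB : ∀ N, ‖f N‖ ≤ B) :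
    ∃ φ : ℕ → ℕ, StrictMono φ ∧ ∃ g : RieszHSpace lam l, ∀ u : ℝ≥0, 0 < u →
      Tendsto (fun j => (f (φ j)).shift u) atTop (𝓝 (g.shift u)) := by
  choose C hC0 hC using RieszHSpace.exists_norm_coeff_le lam l
  -- Coefficients of a bounded sequence lie in a countable product of discs, so a diagonal
  -- subsequence converges coefficientwise.
  have hK : IsCompact (Set.univ.pi fun n => Metric.closedBall (0 : ℂ) (C n * B)) :=
    isCompact_univ_pi fun n => isCompact_closedBall 0 (C n * B)
  obtain ⟨a, -, φ, hφ, ha⟩ := hK.tendsto_subseq (x := fun N => (f N).coeff) fun N n _ => by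
    rw [mem_closedBall_zero_iff]
    exact (hC n (f N)).trans (mul_le_mul_of_nonneg_left (hfB N) (hC0 n))
  obtain ⟨g, -, -, hg⟩ := exists_tendsto_of_tendsto_coeff (f := fun j => f (φ j))
    (fun j => hfB (φ j)) (tendsto_pi_nhds.1 ha)
  exact ⟨φ, hφ, g, hg⟩

/-! The spaces of Dirichlet series as subspaces of `H_{∞,l}`. -/

theorem RieszDSpace.isRieszGerm {lam : Frequency} {l : ℝ≥0} (D : RieszDSpace lam l) :
    IsRieszGerm lam D.coeff D.limitFn.fn :=
  ⟨l, l.2, 0, fun s _ => D.limitFn_spec s⟩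

theorem RieszDSpace.limitFn_injective (lam : Frequency) (l : ℝ≥0) :
    Function.Injective (RieszDSpace.limitFn : RieszDSpace lam l → RieszHSpace lam l) :=
  fun D E h => Subtype.ext (D.limitFn.germ_unique D.isRieszGerm (h ▸ E.isRieszGerm))

theorem RieszDSpace.isometry_limitFn (lam : Frequency) (l : ℝ≥0) :
    Isometry (RieszDSpace.limitFn : RieszDSpace lam l → RieszHSpace lam l) :=
  AddMonoidHomClass.isometry_of_norm (RieszDSpace.limitMap lam l) fun _ => rfl

theorem RieszDSpace.limitFn_translate {lam : Frequency} {l : ℝ≥0} (u : ℝ≥0)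
    (D : RieszDSpace lam l) : (D.translate u).limitFn = D.limitFn.shift u :=
  limitFn_eq _ _ fun s => by
    have h := D.limitFn_spec (shiftPoint u s)
    refine h.congr fun x => ?_
    exact (rieszMean_translate lam l u D.coeff x s).symm

theorem IsRieszGerm.translate {lam : Frequency} {l : ℝ≥0} {f : RieszHSpace lam l} {a : ℕ → ℂ}
    (ha : IsRieszGerm lam a f.fn) (u : ℝ≥0) :
    IsRieszGerm lam (translateCoeff lam u a) (f.shift u).fn := by
  obtain ⟨m, hm, σ, h⟩ := ha
  refine ⟨m, hm, σ, fun s hs => ?_⟩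
  simp only [rieszMean_translate]
  refine h (shiftPoint u s) (hs.trans_le ?_)
  simp [shiftPoint]

/-- If germs are summable of order `l`, then functions are limits of Dirichlet series. -/
theorem exists_limitFn_eq_of_summable {lam : Frequency} {l : ℝ≥0} {f : RieszHSpace lam l}
    {a : ℕ → ℂ} (ha : IsRieszGerm lam a f.fn)
    (hs : ∀ s : ℂ, 0 < s.re → RieszSummableAt lam l a s) :
    ∃ D : RieszDSpace lam l, D.coeff = a ∧ D.limitFn = f := by
  have hlim : IsLimitFunction lam l a f.fn := by
    intro s
    obtain ⟨L, hL⟩ := hs s s.2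
    -- The sum of order `l` is also the sum of the higher order `rieszOrder l`, which is known to be
    -- the value of `f`.
    have h := rieszMean_consistency lam l.2 (le_rieszOrder l) a s L hL
    rwa [tendsto_nhds_unique h (f.tendsto_rieszMean ha s)] at hL
  let D : RieszDSpace lam l := ⟨a, f.fn, f.2, hlim⟩
  exact ⟨D, rfl, D.limitFn_eq f hlim⟩

/-- Uniqueness of germs identifies the coefficients of `D` with those of the translated germ, and
summability of the latter at `t` is summability of `a` at `t + u`. -/
theorem summableAt_of_limitFn {lam : Frequency} {l : ℝ≥0} {f : RieszHSpace lam l} {a : ℕ → ℂ}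
    (ha : IsRieszGerm lam a f.fn)
    (h : ∀ u : ℝ≥0, 0 < u → ∃ D : RieszDSpace lam l, D.limitFn = f.shift u) (s : ℂ)
    (hs : 0 < s.re) : RieszSummableAt lam l a s := by
  obtain ⟨u, t, hu, hut⟩ := exists_shiftPoint_eq ⟨s, hs⟩
  obtain ⟨D, hD⟩ := h u hu
  have hc : D.coeff = translateCoeff lam u a :=
    (f.shift u).germ_unique (hD ▸ D.isRieszGerm) (ha.translate u)
  have h1 := D.limitFn_spec t
  rw [hc] at h1
  refine ⟨_, h1.congr fun x => ?_⟩
  rw [rieszMean_translate]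
  exact congrArg (rieszMean lam l a x) (congrArg Subtype.val hut)

/-- Dirichlet polynomials belong to `D_{∞,l}`. -/
theorem exists_limitFn_eq_polynomial (lam : Frequency) (l : ℝ≥0) (S : Finset ℕ) (c : ℕ → ℂ) :
    ∃ D : RieszDSpace lam l, ∀ s : RightHalfPlane,
      D.limitFn.fn s = ∑ n ∈ S, c n * Complex.exp (-(lam n : ℂ) * s) := by
  classical
  set a : ℕ → ℂ := fun n => if n ∈ S then c n else 0 with ha
  set F : ℂ → ℂ := fun s => ∑ n ∈ S, c n * Complex.exp (-(lam n : ℂ) * s) with hF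
  set f : RightHalfPlane → ℂ := fun s => F s with hf
  have hlim : IsLimitFunction lam l a f := by
    intro s
    have h1 : Tendsto (fun x : ℝ => ∑ n ∈ S, c n * Complex.exp (-(lam n : ℂ) * s)
        * (((1 - lam n / x) ^ (l : ℝ) : ℝ) : ℂ)) atTop (𝓝 (f s)) := by
      refine tendsto_finsetSum _ fun n _ => ?_
      have h2 : Tendsto (fun x : ℝ => 1 - lam n / x) atTop (𝓝 1) := by
        simpa using (tendsto_const_nhds.div_atTop tendsto_id).const_sub (1 : ℝ)
      have h3 : Tendsto (fun x : ℝ => (1 - lam n / x) ^ (l : ℝ)) atTop (𝓝 1) := by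
        simpa using h2.rpow_const (p := (l : ℝ)) (Or.inr l.2)
      have h4 : Tendsto (fun x : ℝ => (((1 - lam n / x) ^ (l : ℝ) : ℝ) : ℂ)) atTop (𝓝 1) := by
        exact_mod_cast (Complex.continuous_ofReal.tendsto 1).comp h3
      simpa using h4.const_mul (c n * Complex.exp (-(lam n : ℂ) * s))
    refine h1.congr' ?_
    have hev : ∀ᶠ x : ℝ in atTop, ∀ n ∈ S, lam n < x :=
      (Finset.eventually_all S).2 fun n _ => eventually_gt_atTop (lam n)
    filter_upwards [hev] with x hx
    rw [rieszMean]
    refine Finset.sum_subset_zero_on_sdiff (fun n hn => ?_) (fun n hn => ?_) fun n hn => ?_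
    · exact (lam.mem_below x n).2 (hx n hn)
    · simp [ha, (Finset.mem_sdiff.1 hn).2]
    · simp [ha, hn]
  have hmem : f ∈ HSubmodule lam l := by
    refine ⟨⟨F, ?_, fun _ => rfl⟩, ?_, a, l, l.2, 0, fun s _ => hlim s⟩
    · exact Differentiable.differentiableOn (by fun_prop)
    · refine HasGrowth.of_le (C := ∑ n ∈ S, ‖c n‖) fun s => ?_
      have hl1 : 1 ≤ (1 + ‖(s : ℂ)‖) ^ (l : ℝ) :=
        Real.one_le_rpow (by linarith [norm_nonneg (s : ℂ)]) l.2
      refine (div_le_self (norm_nonneg _) hl1).trans ((norm_sum_le _ _).trans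
        (Finset.sum_le_sum fun n _ => ?_))
      rw [norm_mul, Complex.norm_exp]
      refine mul_le_of_le_one_right (norm_nonneg _) (Real.exp_le_one_iff.2 ?_)
      have := mul_nonneg (lam.nonneg n) s.2.le
      simpa using this
  let D : RieszDSpace lam l := ⟨a, f, hmem, hlim⟩
  refine ⟨D, fun s => ?_⟩
  rw [D.limitFn_eq ⟨f, hmem⟩ hlim]
  rfl

/-- Translations of functions in `H_{∞,l}` are limits of Dirichlet polynomials. -/
theorem exists_tendsto_limitFn_shift {lam : Frequency} {l : ℝ≥0} (f : RieszHSpace lam l) {u : ℝ≥0}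
    (hu : 0 < u) :
    ∃ P : ℕ → RieszDSpace lam l, Tendsto (fun N => (P N).limitFn) atTop (𝓝 (f.shift u)) := by
  obtain ⟨C, hC0, hC⟩ := exists_norm_rieszMean_sub_le lam l hu
  -- The polynomials are the Riesz means of the translated germ at `x = N + 1`, where the error
  -- estimate is already a bound in norm.
  choose P hP using fun N : ℕ => exists_limitFn_eq_polynomial lam l (lam.below ((N : ℝ) + 1))
    fun n => translateCoeff lam u f.coeff n
      * (((1 - lam n / ((N : ℝ) + 1)) ^ ((rieszOrder l : ℕ) : ℝ) : ℝ) : ℂ)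
  refine ⟨P, ?_⟩
  rw [tendsto_iff_norm_sub_tendsto_zero]
  have h0 : Tendsto (fun N : ℕ => C / ((N : ℝ) + 1) * ‖f‖) atTop (𝓝 0) := by
    simpa using (tendsto_const_nhds.div_atTop
      (tendsto_atTop_add_const_right _ 1 tendsto_natCast_atTop_atTop)).mul_const ‖f‖
  refine squeeze_zero (fun N => norm_nonneg _) (fun N => ?_) h0
  refine RieszHSpace.norm_le_of_forall fun s => ?_
  have h1 := hC f f.coeff f.coeff_spec s ((N : ℝ) + 1) (by
    have : (0 : ℝ) ≤ N := Nat.cast_nonneg N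
    linarith)
  have h2 : (P N).limitFn.fn s
      = rieszMean lam (rieszOrder l) f.coeff ((N : ℝ) + 1) (shiftPoint u s) := by
    have h3 := rieszMean_translate lam (rieszOrder l) u f.coeff ((N : ℝ) + 1) s
    refine Eq.trans ?_ h3
    rw [hP, rieszMean]
    refine Finset.sum_congr rfl fun n _ => ?_
    ring
  rw [← h2] at h1
  exact h1

/-! The equivalences. -/

/-- The isometric image of a complete space is closed; it contains the Dirichlet polynomials and
hence every translate of `f`. -/
theorem summableAt_of_complete {lam : Frequency} {l : ℝ≥0} [CompleteSpace (RieszDSpace lam l)]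
    {f : RieszHSpace lam l} {a : ℕ → ℂ} (ha : IsRieszGerm lam a f.fn) (s : ℂ) (hs : 0 < s.re) :
    RieszSummableAt lam l a s := by
  refine summableAt_of_limitFn ha (fun u hu => ?_) s hs
  obtain ⟨P, hP⟩ := exists_tendsto_limitFn_shift f hu
  have hiso := RieszDSpace.isometry_limitFn lam l
  have hc : CauchySeq P := hiso.isUniformInducing.cauchy_map_iff.1 hP.cauchySeq
  obtain ⟨E, hE⟩ := cauchySeq_tendsto_of_complete hc
  exact ⟨E, tendsto_nhds_unique ((hiso.continuous.tendsto E).comp hE) hP⟩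

theorem RieszHSpace.tendsto_apply {lam : Frequency} {l : ℝ≥0} {f : ℕ → RieszHSpace lam l}
    {g : RieszHSpace lam l} (h : Tendsto f atTop (𝓝 g)) (s : RightHalfPlane) :
    Tendsto (fun N => (f N).fn s) atTop (𝓝 (g.fn s)) := by
  rw [tendsto_iff_norm_sub_tendsto_zero] at h ⊢
  have h0 := h.mul_const ((1 + ‖(s : ℂ)‖) ^ (l : ℝ))
  rw [zero_mul] at h0
  exact squeeze_zero (fun N => norm_nonneg _) (fun N => (f N - g).norm_apply_le s) h0

theorem summableAt_of_montel {lam : Frequency} {l : ℝ≥0} (hM : SatisfiesMontel lam l)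
    {f : RieszHSpace lam l} {a : ℕ → ℂ} (ha : IsRieszGerm lam a f.fn) (s : ℂ) (hs : 0 < s.re) :
    RieszSummableAt lam l a s := by
  refine summableAt_of_limitFn ha (fun u hu => ?_) s hs
  -- The shift is spent in two halves: one to approximate by a bounded sequence of polynomials, the
  -- other to apply Montel's theorem to that sequence.
  have hv : 0 < u / 2 := half_pos hu
  obtain ⟨P, hP⟩ := exists_tendsto_limitFn_shift f hv
  obtain ⟨B, hB⟩ := hP.cauchySeq.norm_bddAbove
  obtain ⟨φ, hφ, E, hE⟩ := hM P ⟨B, fun N => hB ⟨N, rfl⟩⟩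
  refine ⟨E.translate (u / 2), Subtype.ext (funext fun t => ?_)⟩
  have hiso := RieszDSpace.isometry_limitFn lam l
  have h1 := RieszHSpace.tendsto_apply
    ((hiso.continuous.tendsto (E.translate (u / 2))).comp (hE (u / 2) hv)) t
  have h2 := (RieszHSpace.tendsto_apply hP (shiftPoint (u / 2) t)).comp hφ.tendsto_atTop
  have h3 : ∀ j, (RieszDSpace.limitFn ((P (φ j)).translate (u / 2))).fn t
      = (P (φ j)).limitFn.fn (shiftPoint (u / 2) t) := fun j => by
    rw [RieszDSpace.limitFn_translate]
    rfl
  have h4 : f.fn (shiftPoint (u / 2) (shiftPoint (u / 2) t)) = f.fn (shiftPoint u t) := by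
    congr 1
    refine Subtype.ext ?_
    simp only [shiftPoint]
    push_cast
    ring
  exact (tendsto_nhds_unique (h1.congr h3) h2).trans h4

/-- The third condition is the hub: it is surjectivity of the limit map, expressed through germs. -/
theorem mainTheorem7 (lam : Frequency) (l : ℝ≥0) :
    List.TFAE [
      SatisfiesMontel lam l,
      (∀ D : RieszDSpace lam l, ‖D‖ = 0 → D = 0) ∧ CompleteSpace (RieszDSpace lam l),
      ∀ (f : RieszHSpace lam l) (a : ℕ → ℂ), IsRieszGerm lam a f.fn →
        ∀ s : ℂ, 0 < s.re → RieszSummableAt lam l a s,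
      ∃ Φ : RieszDSpace lam l ≃ₗᵢ[ℂ] RieszHSpace lam l,
        ∀ (D : RieszDSpace lam l) (a : ℕ → ℂ), IsRieszGerm lam a (Φ D).fn ↔ a = D.coeff] := by
  tfae_have 1 → 3 := fun h f a ha => summableAt_of_montel h ha
  tfae_have 2 → 3 := fun h f a ha =>
    haveI := h.2
    summableAt_of_complete ha
  tfae_have 3 → 4 := by
    intro h
    have hbij : Function.Bijective (RieszDSpace.limitMap lam l) := by
      refine ⟨RieszDSpace.limitFn_injective lam l, fun f => ?_⟩
      obtain ⟨D, -, hD⟩ := exists_limitFn_eq_of_summable f.coeff_spec (h f _ f.coeff_spec)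
      exact ⟨D, hD⟩
    refine ⟨⟨LinearEquiv.ofBijective (RieszDSpace.limitMap lam l) hbij, fun _ => rfl⟩,
      fun D a => ⟨fun ha => D.limitFn.germ_unique ha D.isRieszGerm, ?_⟩⟩
    rintro rfl
    exact D.isRieszGerm
  tfae_have 4 → 3 := by
    rintro ⟨Φ, hΦ⟩ f a ha s hs
    obtain ⟨D, rfl⟩ := Φ.surjective f
    rw [(hΦ D a).1 ha]
    exact ⟨_, D.limitFn_spec ⟨s, hs⟩⟩
  tfae_have 4 → 2 := by
    rintro ⟨Φ, -⟩
    refine ⟨fun D hD => ?_, Φ.symm.isometry.isUniformInducing.completeSpace_congr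
      Φ.symm.surjective |>.1 inferInstance⟩
    rw [← Φ.norm_map, norm_eq_zero] at hD
    exact Φ.injective (hD.trans Φ.map_zero.symm)
  tfae_have 3 → 1 := by
    rintro h D ⟨B, hB⟩
    obtain ⟨φ, hφ, g, hg⟩ := RieszHSpace.exists_subseq_tendsto_shift
      (f := fun N => (D N).limitFn) hB
    obtain ⟨E, -, rfl⟩ := exists_limitFn_eq_of_summable g.coeff_spec (h g _ g.coeff_spec)
    refine ⟨φ, hφ, E, fun u hu => ?_⟩
    -- Convergence of Dirichlet series can be tested on their limit functions, where Montel's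
    -- theorem holds unconditionally.
    refine (RieszDSpace.isometry_limitFn lam l).isUniformInducing.isInducing.tendsto_nhds_iff.2 ?_
    rw [RieszDSpace.limitFn_translate]
    refine (hg u hu).congr fun j => ?_
    exact (RieszDSpace.limitFn_translate u (D (φ j))).symm
  tfae_finish
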